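/- Fix a prime $p$; all rings are commutative with $1$. Let $R$ be a ring, $I_0\subseteq R$ an ideal, and let $\boldsymbol R=(R_0\xrightarrow{t_0}R_1\xrightarrow{t_1}R_2\to\cdots)$ be a tower of rings. For an $R$-module $M$ let $M_{\mathrm{tor}}$ be the submodule of those $x\in M$ such that every $a\in I_0$ satisfies $a^nx=0$ for some $n>0$. Write $\overline{R_i}=R_i/I_0R_i$. **Preperfectoid towers.** $\boldsymbol R$ is a *preperfectoid tower arising from $(R,I_0)$* if: (a) $R_0=R$ and $p\in I_0$; (b) every induced map $\overline{t_i}\colon\overline{R_i}\to\overline{R_{i+1}}$ is injective; (c) the image of the Frobenius of $\overline{R_{i+1}}$ is contained in the image of $\overline{t_i}$ for all $i$, so that there is a unique ring homomorphism $F_i\colon\overline{R_{i+1}}\to\overline{R_i}$ (the $i$-th Frobenius projection) with $\overline{t_i}(F_i(x))=x^p$; (d) every $F_i$ is surjective; (f) $I_0$ is principal and there is a principal ideal $I_1\subseteq R_1$ with $I_1^p=I_0R_1$ and $\ker F_i=I_1\overline{R_{i+1}}$ for all $i\ge 0$; (g) for every $i\ge0$, $I_0(R_i)_{\mathrm{tor}}=0$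 and there is a bijection $(F_i)_{\mathrm{tor}}\colon(R_{i+1})_{\mathrm{tor}}\to(R_i)_{\mathrm{tor}}$ compatible with $F_i$ via the canonical maps $(R_j)_{\mathrm{tor}}\to\overline{R_j}$. **Pillars.** For such a tower there is a unique sequence of ideals $I_i\subseteq R_i$ $(i\ge0)$, starting with $I_0$ and with an ideal $I_1$ as in (f), such that $I_i$ is finitely generated and contains $I_0R_i$ for $i\ge2$, and $F_i(I_{i+1}\overline{R_{i+1}})=I_i\overline{R_i}$ for all $i\ge0$. The ideal $I_i$ is the *$i$-th perfectoid pillar*. **Tilts.** The *$i$-th small tilt* is $R_i^{s.\flat}=\varprojlim(\cdots\xrightarrow{F_{i+1}}\overline{R_{i+1}}\xrightarrow{F_i}\overline{R_i})$, with projection $\Phi_0^{(i)}\colon R_i^{s.\flat}\to\overline{R_i}$. The *small tilt* of the pillar $I_i$ is $I_i^{s.\flat}=\ker\bigl(R_i^{s.\flat}\xrightarrow{\Phi_0^{(i)}}\overline{R_i}\to R_i/I_i\bigr)$. **Theorem.** Let $\boldsymbol R$ be a preperfectoid tower arising from $(R,I_0)$, with pillars $I_i$, and let $R\to S$ be a weakly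 étale ring homomorphism (that is, $S$ is flat over $R$ and the multiplication map $S\otimes_RS\to S$ is flat). Put $S_i=R_i\otimes_RS$. 1. $\boldsymbol R\otimes_RS=\{S_i,\ t_i\otimes_RS\}_{i\ge0}$ is a preperfectoid tower arising from $(S,I_0S)$ (where $S_0=R\otimes_RS$ is identified with $S$). 2. For every $i\ge0$, the $i$-th perfectoid pillar of $\boldsymbol R\otimes_RS$ is $I_iS_i$, and the small tilt of $I_iS_i$ is $I_i^{s.\flat}S_i^{s.\flat}$, the ideal generated by the image of $I_i^{s.\flat}$ under the ring homomorphism $R_i^{s.\flat}\to S_i^{s.\flat}$ induced by the maps $R_j\to S_j$. Likewise, for every $i\ge0$, $\ker(S_i^{s.\flat}\to S_i/I_0S_i)$ is the ideal of $S_i^{s.\flat}$ generated by the image of $\ker(R_i^{s.\flat}\to R_i/I_0R_i)$. -/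

import Mathlib

open scoped TensorProduct

/-!
Towers of rings are handled relative to their base. A tower `R₀ → R₁ → R₂ → ⋯` with `R₀ = R` is a family
`A i` of `R`-algebras with `R`-algebra maps `t i : A i → A (i + 1)`, such that the structure map
`R → A 0` is bijective (this bijectivity is part of condition (a) below).
-/

namespace PerfectoidTower

noncomputable section

section Tower

variable {R : Type*} [CommRing R] {A : ℕ → Type*} [∀ i, CommRing (A i)] [∀ i, Algebra R (A i)]

/-- The extension `I R_i` of an ideal `I ⊆ R` to the `i`-th ring of the tower. -/
abbrev levelIdeal (A : ℕ → Type*) [∀ i, CommRing (A i)] [∀ i, Algebra R (A i)]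
    (I : Ideal R) (i : ℕ) : Ideal (A i) :=
  I.map (algebraMap R (A i))

/-- The ring `R_i / I₀ R_i`. -/
abbrev LevelQuot (A : ℕ → Type*) [∀ i, CommRing (A i)] [∀ i, Algebra R (A i)]
    (I : Ideal R) (i : ℕ) : Type _ :=
  A i ⧸ levelIdeal A I i

/-- The submodule `M_{I-tor}` of `I`-torsion elements: those `x` such that every `a ∈ I` has a
positive power killing `x`. -/
def idealTorsion (I : Ideal R) (M : Type*) [AddCommGroup M] [Module R M] : Submodule R M where
  carrier := {x | ∀ a ∈ I, ∃ n : ℕ, 0 < n ∧ a ^ n • x = 0}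
  zero_mem' := fun _ _ => ⟨1, one_pos, smul_zero _⟩
  add_mem' := by
    intro x y hx hy a ha
    obtain ⟨n, hn, hnx⟩ := hx a ha
    obtain ⟨m, _, hmy⟩ := hy a ha
    refine ⟨n + m, by omega, ?_⟩
    rw [smul_add, pow_add, mul_smul, mul_smul, hmy, smul_zero, add_zero, smul_comm, hnx, smul_zero]
  smul_mem' := by
    intro c x hx a ha
    obtain ⟨n, hn, hnx⟩ := hx a ha
    exact ⟨n, hn, by rw [smul_comm, hnx, smul_zero]⟩

theorem levelIdeal_le_comap (I : Ideal R) (t : ∀ i, A i →ₐ[R] A (i + 1)) (i : ℕ) :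
    levelIdeal A I i ≤ (levelIdeal A I (i + 1)).comap (t i : A i →+* A (i + 1)) := by
  rw [← Ideal.map_le_iff_le_comap, levelIdeal, Ideal.map_map, AlgHom.comp_algebraMap]

/-- The map `R_i / I₀ R_i → R_{i+1} / I₀ R_{i+1}` induced by `t_i`. -/
def tbar (I : Ideal R) (t : ∀ i, A i →ₐ[R] A (i + 1)) (i : ℕ) :
    LevelQuot A I i →+* LevelQuot A I (i + 1) :=
  Ideal.quotientMap (levelIdeal A I (i + 1)) (t i : A i →+* A (i + 1)) (levelIdeal_le_comap I t i)

/-- Purely inseparable towers arising from `(R, I)`: conditions (a), (b), (c). -/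
structure IsPurelyInseparable (p : ℕ) (I : Ideal R) (t : ∀ i, A i →ₐ[R] A (i + 1)) : Prop where
  base : Function.Bijective (algebraMap R (A 0))
  p_mem : (p : R) ∈ I
  injective : ∀ i, Function.Injective (tbar I t i)
  frobenius_mem : ∀ i, ∀ x : LevelQuot A I (i + 1), x ^ p ∈ (tbar I t i).range

variable {p : ℕ} {I : Ideal R} {t : ∀ i, A i →ₐ[R] A (i + 1)}

theorem natCast_levelQuot (h : (p : R) ∈ I) (i : ℕ) : (p : LevelQuot A I i) = 0 := by
  have h1 : algebraMap R (A i) (p : R) ∈ levelIdeal A I i := Ideal.mem_map_of_mem _ h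
  rw [map_natCast] at h1
  rw [← map_natCast (Ideal.Quotient.mk (levelIdeal A I i))]
  exact Ideal.Quotient.eq_zero_iff_mem.mpr h1

variable [hp : Fact p.Prime]

theorem exists_frobeniusProjection (h : IsPurelyInseparable p I t) (i : ℕ) :
    ∃ F : LevelQuot A I (i + 1) →+* LevelQuot A I i, ∀ x, tbar I t i (F x) = x ^ p := by
  choose f hf using h.frobenius_mem i
  refine ⟨{ toFun := f, map_one' := ?_, map_mul' := ?_, map_zero' := ?_, map_add' := ?_ }, hf⟩
  · exact h.injective i (by rw [hf, map_one, one_pow])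
  · intro x y
    exact h.injective i (by rw [map_mul, hf, hf, hf, mul_pow])
  · exact h.injective i (by rw [hf, map_zero, zero_pow hp.out.ne_zero])
  · intro x y
    refine h.injective i ?_
    obtain ⟨r, hr⟩ := exists_add_pow_prime_eq hp.out x y
    rw [map_add, hf, hf, hf, hr, natCast_levelQuot h.p_mem]
    ring

/-- The `i`-th Frobenius projection: the unique ring homomorphism
`F_i : R_{i+1} / I₀ R_{i+1} → R_i / I₀ R_i` whose composite with `tbar` is the Frobenius. -/
def frobeniusProjection (h : IsPurelyInseparable p I t) (i : ℕ) :
    LevelQuot A I (i + 1) →+* LevelQuot A I i :=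
  (exists_frobeniusProjection h i).choose

theorem tbar_frobeniusProjection (h : IsPurelyInseparable p I t) (i : ℕ)
    (x : LevelQuot A I (i + 1)) : tbar I t i (frobeniusProjection h i x) = x ^ p :=
  (exists_frobeniusProjection h i).choose_spec x

/-- The transition map `t_i ∘ ⋯ ∘ t₁ : R₁ → R_{i+1}`. -/
def transitionFromOne (t : ∀ i, A i →ₐ[R] A (i + 1)) : ∀ i, A 1 →ₐ[R] A (i + 1)
  | 0 => AlgHom.id R (A 1)
  | i + 1 => (t (i + 1)).comp (transitionFromOne t i)

/-- `J ⊆ R₁` is a first perfectoid pillar: it is principal, `J ^ p = I₀ R₁`, and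
`Ker F_i = J (R_{i+1} / I₀ R_{i+1})` for all `i`. -/
structure IsFirstPillar (h : IsPurelyInseparable p I t) (J : Ideal (A 1)) : Prop where
  principal : J.IsPrincipal
  pow_eq : J ^ p = levelIdeal A I 1
  ker_eq : ∀ i, RingHom.ker (frobeniusProjection h i) =
    (J.map (transitionFromOne t i)).map (Ideal.Quotient.mk (levelIdeal A I (i + 1)))

/-- Preperfectoid towers arising from `(R, I)`: purely inseparable towers with the conditions
(d), (f), (g). -/
structure IsPreperfectoid (p : ℕ) [Fact p.Prime] (I : Ideal R) (t : ∀ i, A i →ₐ[R] A (i + 1)) :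
    Prop where
  insep : IsPurelyInseparable p I t
  surjective : ∀ i, Function.Surjective (frobeniusProjection insep i)
  principal : I.IsPrincipal
  exists_firstPillar : ∃ J : Ideal (A 1), IsFirstPillar insep J
  smul_torsion : ∀ i, I • idealTorsion I (A i) = ⊥
  exists_torsionMap : ∀ i, ∃ f : idealTorsion I (A (i + 1)) → idealTorsion I (A i),
    Function.Bijective f ∧ ∀ x : idealTorsion I (A (i + 1)),
      Ideal.Quotient.mk (levelIdeal A I i) (f x : A i) =
        frobeniusProjection insep i (Ideal.Quotient.mk (levelIdeal A I (i + 1)) (x : A (i + 1)))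

/-- The defining property of the sequence of perfectoid pillars: `J₀ = I₀` (inside `R₀ = R`), `J₁`
is the first perfectoid pillar, and for `i ≥ 2` the ideal `J_i` is finitely generated and contains
`I₀ R_i`; moreover `F_i` maps the image of `J_{i+1}` onto the image of `J_i`, for all `i`. -/
structure IsPillarSequence (h : IsPurelyInseparable p I t) (J : ∀ i, Ideal (A i)) : Prop where
  zero : J 0 = levelIdeal A I 0
  one : IsFirstPillar h (J 1)
  fg : ∀ i, 2 ≤ i → (J i).FG
  le : ∀ i, 2 ≤ i → levelIdeal A I i ≤ J i
  image_eq : ∀ i, frobeniusProjection h i ''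
      ((J (i + 1)).map (Ideal.Quotient.mk (levelIdeal A I (i + 1))) : Set (LevelQuot A I (i + 1))) =
    ((J i).map (Ideal.Quotient.mk (levelIdeal A I i)) : Set (LevelQuot A I i))

/-- A first pillar `K` satisfies `K R_{i+1} ⊆ J_{i+1}` modulo `I₀ R_{i+1}`, for `J` a sequence of
ideals as in the definition of pillars. -/
theorem firstPillar_le (h : IsPurelyInseparable p I t) (a : ∀ i, Ideal (LevelQuot A I i))
    (ha : ∀ i, ∀ y ∈ a i, ∃ x ∈ a (i + 1), frobeniusProjection h i x = y)
    (K : Ideal (A 1)) (hK : K.map (Ideal.Quotient.mk (levelIdeal A I 1)) ≤ a 1) (i : ℕ) :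
    (K.map (transitionFromOne t i)).map (Ideal.Quotient.mk (levelIdeal A I (i + 1))) ≤
      a (i + 1) := by
  induction i with
  | zero =>
    refine le_trans (Ideal.map_mono ?_) hK
    rw [Ideal.map_le_iff_le_comap]
    exact fun x hx => hx
  | succ i ih =>
    rw [Ideal.map_le_iff_le_comap, Ideal.map_le_iff_le_comap]
    intro x hx
    have h1 : Ideal.Quotient.mk (levelIdeal A I (i + 1)) (transitionFromOne t i x) ∈ a (i + 1) :=
      ih (Ideal.mem_map_of_mem _ (Ideal.mem_map_of_mem _ hx))
    obtain ⟨y, hy, hyx⟩ := ha (i + 1) _ h1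
    have h2 : tbar I t (i + 1) (frobeniusProjection h (i + 1) y) ∈ a (i + 1 + 1) := by
      rw [tbar_frobeniusProjection]
      exact Ideal.pow_mem_of_mem _ hy _ hp.out.pos
    rw [hyx] at h2
    exact h2

theorem fg_comap {B C : Type*} [CommRing B] [CommRing C] (f : B →+* C)
    (hf : Function.Surjective f) (hk : (RingHom.ker f).FG) (a : Ideal C) (ha : a.FG) :
    (a.comap f).FG := by
  classical
  obtain ⟨s, rfl⟩ := ha
  have h1 : Ideal.map f (Ideal.span (s.image (Function.surjInv hf) : Finset B)) =
      Ideal.span (s : Set C) := by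
    rw [Ideal.map_span, Finset.coe_image, ← Set.image_comp]
    congr 1
    ext x
    simp [Function.surjInv_eq hf]
  change (Ideal.comap f (Ideal.span (s : Set C))).FG
  rw [← h1, Ideal.comap_map_of_surjective f hf]
  exact Submodule.FG.sup ⟨_, rfl⟩ hk

theorem IsPillarSequence.eq_comap {h : IsPurelyInseparable p I t} {J : ∀ i, Ideal (A i)}
    (hJ : IsPillarSequence h J) (i : ℕ) :
    J (i + 1) = (((J i).map (Ideal.Quotient.mk (levelIdeal A I i))).comap
      (frobeniusProjection h i)).comap (Ideal.Quotient.mk (levelIdeal A I (i + 1))) := by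
  have hle : levelIdeal A I (i + 1) ≤ J (i + 1) := by
    rcases Nat.eq_zero_or_pos i with rfl | hi
    · exact hJ.one.pow_eq ▸ Ideal.pow_le_self hp.out.ne_zero
    · exact hJ.le (i + 1) (by omega)
  have himg := fun i => Set.ext_iff.mp (hJ.image_eq i)
  have hker : RingHom.ker (frobeniusProjection h i) ≤
      (J (i + 1)).map (Ideal.Quotient.mk (levelIdeal A I (i + 1))) := by
    rw [hJ.one.ker_eq i]
    exact firstPillar_le h (fun i => (J i).map (Ideal.Quotient.mk (levelIdeal A I i)))
      (fun i y hy => (himg i y).mpr hy) (J 1) le_rfl i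
  conv_lhs => rw [← Ideal.comap_map_mk hle]
  congr 1
  apply le_antisymm
  · intro x hx
    exact (himg i _).mp ⟨x, hx, rfl⟩
  · intro x hx
    obtain ⟨y, hy, hyx⟩ := (himg i _).mpr hx
    have hxy : x - y ∈ RingHom.ker (frobeniusProjection h i) := by
      rw [RingHom.mem_ker, map_sub, hyx, sub_self]
    have := Ideal.add_mem _ (hker hxy) hy
    rwa [sub_add_cancel] at this

/-- A preperfectoid tower has exactly one sequence of perfectoid pillars. -/
theorem existsUnique_isPillarSequence (h : IsPreperfectoid p I t) :
    ∃! J : ∀ i, Ideal (A i), IsPillarSequence h.insep J := by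
  let F := frobeniusProjection h.insep
  let q : ∀ i, A i →+* LevelQuot A I i := fun i => Ideal.Quotient.mk (levelIdeal A I i)
  have hq : ∀ i, Function.Surjective (q i) := fun i => Ideal.Quotient.mk_surjective
  have hqk : ∀ i, RingHom.ker (q i) = levelIdeal A I i := fun i => Ideal.mk_ker
  have hlfg : ∀ i, (levelIdeal A I i).FG := fun i => Ideal.FG.map h.principal.fg _
  obtain ⟨K, hK⟩ := h.exists_firstPillar
  let J : ∀ i, Ideal (A i) := fun i => Nat.rec (levelIdeal A I 0)
    (fun i Ji => ((Ji.map (q i)).comap (F i)).comap (q (i + 1))) i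
  have hJs : ∀ i, J (i + 1) = (((J i).map (q i)).comap (F i)).comap (q (i + 1)) := fun _ => rfl
  have hJ1 : J 1 = K := by
    have h0 : (J 0).map (q 0) = ⊥ := Ideal.map_quotient_self _
    have h1 : RingHom.ker (F 0) = K.map (q 1) := by
      have h3 : K.map (transitionFromOne t 0) = K := Ideal.map_id K
      have h2 := hK.ker_eq 0
      rw [h3] at h2
      exact h2
    have h4 : J 1 = ((K.map (q 1)).comap (q 1)) := by
      rw [← h1, RingHom.ker, ← h0]
      exact hJs 0
    rw [h4]
    exact Ideal.comap_map_mk (hK.pow_eq ▸ Ideal.pow_le_self hp.out.ne_zero)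
  have hfg : ∀ i, (J i).FG := by
    intro i
    induction i with
    | zero => exact hlfg 0
    | succ i ih =>
      rw [hJs]
      refine fg_comap _ (hq _) ((hqk _).symm ▸ hlfg _) _ (fg_comap _ (h.surjective i) ?_ _
        (Ideal.FG.map ih _))
      rw [hK.ker_eq]
      exact Ideal.FG.map (Ideal.FG.map hK.principal.fg _) _
  refine ⟨J, ⟨rfl, hJ1.symm ▸ hK, fun i _ => hfg i, ?_, ?_⟩, ?_⟩
  · intro i hi
    obtain ⟨j, rfl⟩ : ∃ j, i = j + 1 := ⟨i - 1, by omega⟩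
    rw [hJs]
    exact (hqk (j + 1)).ge.trans (Ideal.comap_mono bot_le)
  · intro i
    change F i '' ((J (i + 1)).map (q (i + 1)) : Set _) = ((J i).map (q i) : Set _)
    rw [hJs, Ideal.map_comap_of_surjective _ (hq _)]
    exact Set.image_preimage_eq ((J i).map (q i) : Set (LevelQuot A I i)) (h.surjective i)
  · intro J' hJ'
    funext i
    induction i with
    | zero => exact hJ'.zero
    | succ i ih => rw [hJ'.eq_comap i, ih]

/-- The `i`-th perfectoid pillar `I_i ⊆ R_i`. -/
def pillar (h : IsPreperfectoid p I t) : ∀ i, Ideal (A i) :=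
  (existsUnique_isPillarSequence h).choose

theorem isPillarSequence_pillar (h : IsPreperfectoid p I t) :
    IsPillarSequence h.insep (pillar h) :=
  (existsUnique_isPillarSequence h).choose_spec.1

/-- The `i`-th inverse quasi-perfection, which is the `i`-th small tilt `R_i^{s.♭}` when the tower is
preperfectoid: the limit of `⋯ → R_{i+2} / I₀ R_{i+2} → R_{i+1} / I₀ R_{i+1} → R_i / I₀ R_i` along
the Frobenius projections. -/
def smallTilt (h : IsPurelyInseparable p I t) (i : ℕ) :
    Subring (∀ m, LevelQuot A I (i + m)) where
  carrier := {x | ∀ m, frobeniusProjection h (i + m) (x (m + 1)) = x m}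
  mul_mem' := fun hx hy m => (map_mul _ _ _).trans (congrArg₂ (· * ·) (hx m) (hy m))
  one_mem' := fun _ => map_one _
  add_mem' := fun hx hy m => (map_add _ _ _).trans (congrArg₂ (· + ·) (hx m) (hy m))
  zero_mem' := fun _ => map_zero _
  neg_mem' := fun hx m => (map_neg _ _).trans (congrArg Neg.neg (hx m))

/-- The `0`-th projection `Φ₀ : R_i^{s.♭} → R_i / I₀ R_i`. -/
def smallTiltProj (h : IsPurelyInseparable p I t) (i : ℕ) : smallTilt h i →+* LevelQuot A I i :=
  (Pi.evalRingHom (fun m => LevelQuot A I (i + m)) 0).comp (smallTilt h i).subtype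

/-- The small tilt `I_i^{s.♭}` of the `i`-th perfectoid pillar: the kernel of
`R_i^{s.♭} → R_i / I₀ R_i → R_i / I_i`, the latter ring being written as the quotient of
`R_i / I₀ R_i` by the image of `I_i`. -/
def pillarTilt (h : IsPreperfectoid p I t) (i : ℕ) : Ideal (smallTilt h.insep i) :=
  RingHom.ker ((Ideal.Quotient.mk
    ((pillar h i).map (Ideal.Quotient.mk (levelIdeal A I i)))).comp (smallTiltProj h.insep i))

section Map

variable {S : Type*} [CommRing S] {B : ℕ → Type*} [∀ i, CommRing (B i)] [∀ i, Algebra S (B i)]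
  {I' : Ideal S} {u : ∀ i, B i →ₐ[S] B (i + 1)}

theorem quotientMap_frobeniusProjection (h : IsPurelyInseparable p I t)
    (h' : IsPurelyInseparable p I' u) (α : ∀ i, A i →+* B i)
    (hα : ∀ i x, α (i + 1) (t i x) = u i (α i x))
    (hI : ∀ i, levelIdeal A I i ≤ (levelIdeal B I' i).comap (α i)) (i : ℕ)
    (x : LevelQuot A I (i + 1)) :
    frobeniusProjection h' i (Ideal.quotientMap _ (α (i + 1)) (hI (i + 1)) x) =
      Ideal.quotientMap _ (α i) (hI i) (frobeniusProjection h i x) := by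
  have key : ∀ y : LevelQuot A I i, tbar I' u i (Ideal.quotientMap _ (α i) (hI i) y) =
      Ideal.quotientMap _ (α (i + 1)) (hI (i + 1)) (tbar I t i y) := by
    intro y
    obtain ⟨y, rfl⟩ := Ideal.Quotient.mk_surjective y
    exact congrArg (Ideal.Quotient.mk (levelIdeal B I' (i + 1))) (hα i y).symm
  refine h'.injective i ?_
  rw [tbar_frobeniusProjection, key, tbar_frobeniusProjection, map_pow]

/-- The ring homomorphism `R_i^{s.♭} → S_i^{s.♭}` induced by a morphism of towers `α` that carries
`I₀ R_i` into `J₀ S_i`. -/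
def smallTiltMap (h : IsPurelyInseparable p I t)
    (h' : IsPurelyInseparable p I' u) (α : ∀ i, A i →+* B i)
    (hα : ∀ i x, α (i + 1) (t i x) = u i (α i x))
    (hI : ∀ i, levelIdeal A I i ≤ (levelIdeal B I' i).comap (α i)) (i : ℕ) :
    smallTilt h i →+* smallTilt h' i :=
  ((RingHom.pi fun m => (Ideal.quotientMap (levelIdeal B I' (i + m)) (α (i + m))
      (hI (i + m))).comp (Pi.evalRingHom (fun m => LevelQuot A I (i + m)) m)).comp
    (smallTilt h i).subtype).codRestrict (smallTilt h' i) fun x m =>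
      (quotientMap_frobeniusProjection h h' α hα hI (i + m) _).trans
        (congrArg (Ideal.quotientMap (levelIdeal B I' (i + m)) (α (i + m)) (hI (i + m)))
          (x.2 m))

end Map

end Tower

section BaseChange

variable {R : Type*} [CommRing R] {A : ℕ → Type*} [∀ i, CommRing (A i)] [∀ i, Algebra R (A i)]
  (S : Type*) [CommRing S] [Algebra R S]

/-- The transition maps of the base change to `S`, a tower with rings `S_i = S ⊗_R R_i`. -/
def baseChange (t : ∀ i, A i →ₐ[R] A (i + 1)) (i : ℕ) :
    (S ⊗[R] A i) →ₐ[S] (S ⊗[R] A (i + 1)) :=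
  Algebra.TensorProduct.map (AlgHom.id S S) (t i)

/-- The canonical map `R_i → S_i`, `x ↦ 1 ⊗ x`. -/
def toBaseChange (A : ℕ → Type*) [∀ i, CommRing (A i)] [∀ i, Algebra R (A i)] (i : ℕ) :
    A i →+* S ⊗[R] A i :=
  (Algebra.TensorProduct.includeRight : A i →ₐ[R] S ⊗[R] A i)

theorem toBaseChange_comm (t : ∀ i, A i →ₐ[R] A (i + 1)) (i : ℕ) (x : A i) :
    toBaseChange S A (i + 1) (t i x) = baseChange S t i (toBaseChange S A i x) := by
  simp [toBaseChange, baseChange]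

theorem levelIdeal_le_comap_toBaseChange (I : Ideal R) (i : ℕ) :
    levelIdeal A I i ≤ (levelIdeal (fun i => S ⊗[R] A i) (I.map (algebraMap R S)) i).comap
      (toBaseChange S A i) := by
  rw [← Ideal.map_le_iff_le_comap, levelIdeal, levelIdeal, Ideal.map_map, Ideal.map_map]
  apply le_of_eq
  congr 1
  ext r
  simp [toBaseChange, Algebra.algebraMap_eq_smul_one]

variable {p : ℕ} [Fact p.Prime] {I : Ideal R} {t : ∀ i, A i →ₐ[R] A (i + 1)}

/-- The ring homomorphism `R_i^{s.♭} → S_i^{s.♭}` induced by the maps `R_j → S_j = S ⊗_R R_j`. -/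
def smallTiltToBaseChange (h : IsPurelyInseparable p I t)
    (h' : IsPurelyInseparable p (I.map (algebraMap R S)) (baseChange S t)) (i : ℕ) :
    smallTilt h i →+* smallTilt h' i :=
  smallTiltMap h h' (toBaseChange S A) (toBaseChange_comm S t)
    (levelIdeal_le_comap_toBaseChange S I) i

end BaseChange

end

end PerfectoidTower

open PerfectoidTower

/-! The engine is that the relative Frobenius of a weakly étale algebra `l` over a ring `k` of
characteristic `p` is an isomorphism. It is a map between weakly étale algebras over the Frobenius
copy of `k`, hence flat; it is an epimorphism and a homeomorphism on spectra, so it is a faithfully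
flat epimorphism. Consequently a bijective Frobenius-semilinear map of modules stays bijective after
base change (`exists_addEquiv_tensor_of_smul_eq_zero`).

Modulo `I₀` the Frobenius projection of the new tower is `s ⊗ x ↦ s ^ p ⊗ F x`. Applying the engine
to the semilinear bijection induced by `F` on the quotient by its kernel shows that the new
projection is surjective with kernel extended from `ker F`. Applying it to the torsion bijections
gives those of the new tower: since `I₀` kills the torsion, torsion is the kernel of one generator,
so it commutes with flat base change. Pillars then base change by uniqueness.

For the tilts, choose a generator of the first pillar and successive preimages under the Frobenius
projections. The resulting element of the small tilt generates the tilt of the `i`-th pillar, and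
its `p ^ i`-th power generates the kernel of the projection to `R_i / I₀ R_i`. Its image after base
change is an element of the same kind, so both ideals are extended. -/

namespace PerfectoidTower

/-! ### Relative Frobenius of weakly étale algebras -/

section RelativeFrobenius

universe u

/-- A module over a weakly étale algebra that is flat over the base is flat. -/
theorem flat_of_weaklyEtale (A B C : Type u) [CommRing A] [CommRing B] [CommRing C]
    [Algebra A B] [Algebra B C] [Algebra A C] [IsScalarTower A B C]
    [Algebra.WeaklyEtale A B] [Module.Flat A C] : Module.Flat B C := by
  -- Factor `B → C ⊗[A] B → C ⊗[B] B = C`: the first map is a base change of the flat map `A → C`,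
  -- the second is flat because the multiplication of `B` over `A` is.
  have h1 := RingHom.Flat.mapOfCompatibleSMul C B (Algebra.WeaklyEtale.flat_lmul' A B)
  have h2 : (Algebra.TensorProduct.includeRight : B →ₐ[A] C ⊗[A] B).toRingHom.Flat := by
    have h : Module.Flat B (B ⊗[A] C) := inferInstance
    rw [← RingHom.flat_algebraMap_iff] at h
    have h' := h.comp (RingHom.Flat.of_bijective
      (Algebra.TensorProduct.comm A B C).bijective)
    convert h' using 1
    ext x
    rfl
  have h3 := (h2.comp h1).comp (RingHom.Flat.of_bijective
      (Algebra.TensorProduct.rid B B C).bijective)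
  rw [← RingHom.flat_algebraMap_iff]
  convert h3 using 1
  ext x
  exact Algebra.algebraMap_eq_smul_one x

variable {p : ℕ} [hp : Fact p.Prime]

theorem exists_powRingHom {k : Type*} [CommRing k] (hk : (p : k) = 0) :
    ∃ σ : k →+* k, ∀ x, σ x = x ^ p := by
  refine ⟨{ toFun := fun x => x ^ p, map_one' := one_pow p, map_mul' := fun x y => mul_pow x y p,
            map_zero' := zero_pow hp.out.ne_zero, map_add' := fun x y => ?_ }, fun x => rfl⟩
  obtain ⟨r, hr⟩ := exists_add_pow_prime_eq hp.out x y
  change (x + y) ^ p = x ^ p + y ^ p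
  rw [hr, hk]
  ring

/-- The `p`-th power is additive here, so induction on tensors applies to statements about `x ^ p`;
a two-variable `P` lets additivity be stated without powers. -/
theorem tmul_sum_pow {A B C : Type*} [CommRing A] [CommRing B] [CommRing C] [Algebra A B]
    [Algebra A C] (hA : (p : A) = 0) (P : B ⊗[A] C → B ⊗[A] C → Prop)
    (h0 : P 0 0) (ht : ∀ b c, P (b ⊗ₜ c) ((b ^ p) ⊗ₜ[A] (c ^ p)))
    (ha : ∀ x y x' y', P x x' → P y y' → P (x + y) (x' + y')) (x : B ⊗[A] C) : P x (x ^ p) := by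
  obtain ⟨σ, hσ⟩ := exists_powRingHom (p := p) (k := B ⊗[A] C)
    (by rw [← map_natCast (algebraMap A (B ⊗[A] C)), hA, map_zero])
  rw [← hσ]
  induction x with
  | zero => simpa using h0
  | tmul b c => rw [hσ, Algebra.TensorProduct.tmul_pow]; exact ht b c
  | add x y hx hy => rw [map_add]; exact ha _ _ _ _ hx hy

/-- On `b ⊗ c` the factor `c ^ p` comes from `T` and crosses the tensor sign. In particular the
kernel of multiplication consists of nilpotents. -/
theorem tmul_self_pow {T S : Type*} [CommRing T] [CommRing S] [Algebra T S] (hT : (p : T) = 0)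
    (h : ∀ x : S, x ^ p ∈ (algebraMap T S).range) (z : S ⊗[T] S) :
    z ^ p = ((Algebra.TensorProduct.lmul' T (S := S) z) ^ p) ⊗ₜ[T] (1 : S) := by
  obtain ⟨σ, hσ⟩ := exists_powRingHom (p := p) (k := S)
    (by rw [← map_natCast (algebraMap T S), hT, map_zero])
  refine tmul_sum_pow hT
    (fun z w => w = ((Algebra.TensorProduct.lmul' T (S := S) z) ^ p) ⊗ₜ[T] (1 : S)) ?_ ?_ ?_ z
  · simp [hp.out.ne_zero]
  · intro b c
    obtain ⟨t, ht⟩ := h c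
    simp only [Algebra.TensorProduct.lmul'_apply_tmul, mul_pow]
    rw [← ht, Algebra.algebraMap_eq_smul_one, ← TensorProduct.smul_tmul]
    simp
  · intro x y x' y' hx hy
    simp only [hx, hy, map_add, ← hσ, TensorProduct.add_tmul]

/-- The kernel of a flat surjective ring homomorphism is a pure ideal. -/
theorem exists_eq_mul_of_algebraMap_eq_zero {D S : Type*} [CommRing D] [CommRing S] [Algebra D S]
    [Module.Flat D S] (hμ : Function.Surjective (algebraMap D S)) {x : D}
    (hx : algebraMap D S x = 0) : ∃ y, algebraMap D S y = 0 ∧ x = x * y := by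
  -- The equational criterion applied to `x • 1 = 0` gives `1 = ∑ b j • y j` with `x * b j = 0`;
  -- lifting each `y j` to `d j`, the element `1 - ∑ b j * d j` acts as the identity on `x`.
  obtain ⟨n, b, y, h1, h2⟩ := Module.Flat.isTrivialRelation_of_sum_smul_eq_zero
    (R := D) (M := S) (f := fun _ : Fin 1 => x) (x := fun _ => 1)
    (by rw [Fin.sum_univ_one, Algebra.smul_def, hx, zero_mul])
  have h1 : (1 : S) = ∑ j, b 0 j • y j := h1 0
  simp only [Fin.sum_univ_one] at h2
  choose d hd using fun j => hμ (y j)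
  refine ⟨1 - ∑ j, b 0 j * d j, ?_, ?_⟩
  · rw [map_sub, map_one, sub_eq_zero, h1, map_sum]
    refine Finset.sum_congr rfl fun j _ => ?_
    rw [map_mul, hd, Algebra.smul_def]
  · rw [mul_sub, mul_one, Finset.mul_sum, Finset.sum_eq_zero, sub_zero]
    intro j _
    rw [← mul_assoc, h2 j, zero_mul]

/-- If the target is weakly étale over `k`, then a ring homomorphism through which the Frobenius
of the target factors is an epimorphism of rings. -/
theorem isEpi_of_pow_mem_range {k T S : Type*} [CommRing k] [CommRing T] [CommRing S]
    [Algebra k T] [Algebra T S] [Algebra k S] [IsScalarTower k T S] [Algebra.WeaklyEtale k S]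
    (hk : (p : k) = 0) (h : ∀ x : S, x ^ p ∈ (algebraMap T S).range) : Algebra.IsEpi T S := by
  have hT : (p : T) = 0 := by rw [← map_natCast (algebraMap k T), hk, map_zero]
  rw [Algebra.isEpi_iff_forall_one_tmul_eq]
  intro a
  obtain ⟨y, hy, hxy⟩ : ∃ y, Algebra.TensorProduct.lmul' k (S := S) y = 0 ∧
      (1 : S) ⊗ₜ[k] a - a ⊗ₜ 1 = (1 ⊗ₜ[k] a - a ⊗ₜ 1) * y := by
    let := (Algebra.TensorProduct.lmul' k (S := S)).toRingHom.toAlgebra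
    have : Module.Flat (S ⊗[k] S) S := Algebra.WeaklyEtale.flat_lmul' k S
    exact exists_eq_mul_of_algebraMap_eq_zero (D := S ⊗[k] S) (S := S)
      (fun s => ⟨s ⊗ₜ 1, mul_one s⟩) ((map_sub _ _ _).trans
        (sub_eq_zero.mpr ((one_mul a).trans (mul_one a).symm)))
  let π : S ⊗[k] S →ₐ[k] S ⊗[T] S := Algebra.TensorProduct.mapOfCompatibleSMul T k k S S
  have hc : ∀ z, Algebra.TensorProduct.lmul' T (S := S) (π z) =
      Algebra.TensorProduct.lmul' k (S := S) z := by
    intro z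
    induction z with
    | zero => simp
    | tmul b c => simp [π]
    | add x y hx hy => simp only [map_add, hx, hy]
  -- In `S ⊗[T] S` the multiplier `y` becomes nilpotent, while `1 ⊗ a - a ⊗ 1` is unchanged on
  -- multiplying by it any number of times; hence that difference vanishes.
  have hnil : (π y) ^ p = 0 := by
    rw [tmul_self_pow hT h, hc, hy, zero_pow hp.out.ne_zero, TensorProduct.zero_tmul]
  have hpx : ∀ (m : ℕ), (1 : S) ⊗ₜ[T] a - a ⊗ₜ[T] 1 =
      (1 ⊗ₜ[T] a - a ⊗ₜ[T] 1) * π y ^ m := by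
    have h1 : (1 : S) ⊗ₜ[T] a - a ⊗ₜ[T] 1 = (1 ⊗ₜ[T] a - a ⊗ₜ[T] 1) * π y := by
      have := congrArg π hxy
      rw [map_mul, map_sub] at this
      exact this
    intro m
    induction m with
    | zero => rw [pow_zero, mul_one]
    | succ m ih => rw [pow_succ, ← mul_assoc, ← ih, ← h1]
  have h0 := hpx p
  rw [hnil, mul_zero] at h0
  exact sub_eq_zero.mp h0

/-- The map is flat by cancellation and a homeomorphism on spectra by the two power conditions, so
it is faithfully flat; a faithfully flat epimorphism is an isomorphism. -/
theorem bijective_of_weaklyEtale_of_pow_mem_range {k T S : Type u} [CommRing k] [CommRing T]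
    [CommRing S] [Algebra k T] [Algebra T S] [Algebra k S] [IsScalarTower k T S]
    [Algebra.WeaklyEtale k T] [Algebra.WeaklyEtale k S] (hk : (p : k) = 0)
    (h : ∀ x : S, x ^ p ∈ (algebraMap T S).range)
    (hker : ∀ x : T, algebraMap T S x = 0 → x ^ p = 0) :
    Function.Bijective (algebraMap T S) := by
  have := isEpi_of_pow_mem_range hk h
  have := flat_of_weaklyEtale k T S
  have hsp := (PrimeSpectrum.isHomeomorph_comap (algebraMap T S)
    (fun x => ⟨p, hp.out.pos, h x⟩) (fun x hx => ⟨p, hker x hx⟩)).surjective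
  have := Module.FaithfullyFlat.of_comap_surjective hsp
  refine ⟨FaithfulSMul.algebraMap_injective T S, ?_⟩
  -- After tensoring with `S`, surjectivity is clear: for an epimorphism `a ⊗ b = (a * b) ⊗ 1`.
  refine (Module.FaithfullyFlat.lTensor_surjective_iff_surjective T S
    (Algebra.linearMap T S)).mp fun z => ?_
  induction z with
  | zero => exact ⟨0, map_zero _⟩
  | tmul a b =>
    refine ⟨(a * b) ⊗ₜ 1, ?_⟩
    have := (Algebra.isEpi_iff_forall_one_tmul_eq T S).mp inferInstance b
    have h2 := congrArg (fun z => (a ⊗ₜ[T] (1 : S)) * z) this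
    simp only [Algebra.TensorProduct.tmul_mul_tmul, mul_one, one_mul] at h2
    simp [h2]
  | add x y hx hy =>
    obtain ⟨x', rfl⟩ := hx
    obtain ⟨y', rfl⟩ := hy
    exact ⟨x' + y', map_add _ _ _⟩

end RelativeFrobenius

/-! ### Base change of Frobenius-semilinear bijections -/

section FrobeniusSemilinear

universe u v w

/-- The bijectivity criterion needs its rings in a single universe. These lifted copies of `k` and
`l` serve as the targets of Frobenius. -/
theorem exists_ulift_weaklyEtale (k : Type u) (l : Type v) [CommRing k] [CommRing l] [Algebra k l]
    [Algebra.WeaklyEtale k l] : ∃ (k' l' : Type (max u v)) (_ : CommRing k') (_ : CommRing l')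
      (_ : Algebra k' l') (_ : Algebra.WeaklyEtale k' l') (σ : k' ≃+* k) (τ : l' ≃+* l),
      ∀ x, τ (algebraMap k' l' x) = algebraMap k l (σ x) := by
  let : Algebra (ULift.{v} k) l := ULift.algebra' _ _
  exact ⟨ULift.{v} k, ULift.{u} l, inferInstance, inferInstance, inferInstance,
    Algebra.WeaklyEtale.ulift_iff.mpr ‹_›, ULift.ringEquiv, ULift.ringEquiv, fun _ => rfl⟩

/-- Since `k` acts on `M` through `k'`, one has `l ⊗[k] M ≃ M ⊗[k'] (k' ⊗[k] l)`. The relative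
Frobenius turns the second factor into `l'`, and `τ` and `g` identify `l' ⊗[k'] M` with `l ⊗[k] N`.
-/
theorem exists_addEquiv_tensor_of_relativeFrobenius {p : ℕ} {k k' l l' : Type*} [CommRing k]
    [CommRing l] [CommRing k'] [CommRing l'] [Algebra k l] [Algebra k k'] [Algebra k' l']
    [Algebra l l'] [Algebra k l'] [IsScalarTower k l l'] [IsScalarTower k k' l']
    (he : Function.Bijective
      (Algebra.TensorProduct.productLeftAlgHom (Algebra.ofId k' l')
        (IsScalarTower.toAlgHom k l l')))
    (σ : k' ≃+* k) (τ : l' ≃+* l) (hτ : ∀ x, τ (algebraMap l l' x) = x ^ p)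
    (hστ : ∀ x, τ (algebraMap k' l' x) = algebraMap k l (σ x))
    {M N : Type*} [AddCommGroup M] [AddCommGroup N] [Module k M] [Module k N] [Module k' M]
    [IsScalarTower k k' M]
    (g : M ≃+ N) (hg : ∀ (r : k') m, g (r • m) = σ r • g m) :
    ∃ G : l ⊗[k] M ≃+ l ⊗[k] N, ∀ s m, G (s ⊗ₜ m) = (s ^ p) ⊗ₜ[k] g m := by
  have := RingHomInvPair.of_ringEquiv σ
  have := RingHomInvPair.symm (σ : k' →+* k) (σ.symm : k →+* k')
  let τ' : l' ≃ₛₗ[(σ : k' →+* k)] l :=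
    { τ.toAddEquiv with
      map_smul' := fun r x => by
        change τ (r • x) = σ r • τ x
        rw [Algebra.smul_def, map_mul, hστ, Algebra.smul_def] }
  let g' : M ≃ₛₗ[(σ : k' →+* k)] N := { g with map_smul' := hg }
  let E := LinearEquiv.ofBijective _ he
  let G1 : l ⊗[k] M ≃ₗ[k] M ⊗[k] l := TensorProduct.comm k l M
  let G2 : M ⊗[k] l ≃ₗ[k'] M ⊗[k'] (k' ⊗[k] l) :=
    (TensorProduct.AlgebraTensorModule.cancelBaseChange k k' k' M l).symm
  let G3 : M ⊗[k'] (k' ⊗[k] l) ≃ₗ[k'] M ⊗[k'] l' := TensorProduct.congr (.refl k' M) E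
  let G4 : M ⊗[k'] l' ≃ₗ[k'] l' ⊗[k'] M := TensorProduct.comm k' M l'
  let G5 : l' ⊗[k'] M ≃+ l ⊗[k] N := (TensorProduct.congr τ' g').toAddEquiv
  refine ⟨G1.toAddEquiv.trans (G2.toAddEquiv.trans (G3.toAddEquiv.trans
    (G4.toAddEquiv.trans G5))), fun s m => ?_⟩
  change G5 (G4 (G3 (G2 (G1 (s ⊗ₜ m))))) = _
  simp only [G1, G2, G3, G4, TensorProduct.comm_tmul,
    TensorProduct.AlgebraTensorModule.cancelBaseChange_symm_tmul, TensorProduct.congr_tmul]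
  change τ (E _) ⊗ₜ g m = _
  rw [← hτ]
  congr 2
  change Algebra.TensorProduct.productLeftAlgHom _ _ _ = _
  simp

variable {p : ℕ} [hp : Fact p.Prime]

/-- The relative Frobenius of a weakly étale algebra in characteristic `p` is an isomorphism. The
Frobenius endomorphisms are written as `k → k'` and `l → l'` with `k'` and `l'` copies of
`k` and `l`. -/
theorem relativeFrobenius_bijective {k : Type w} {l : Type v} {k' l' : Type (max u v)} [CommRing k]
    [CommRing l] [CommRing k'] [CommRing l'] [Algebra k l] [Algebra k k'] [Algebra k' l']
    [Algebra l l'] [Algebra k l'] [IsScalarTower k l l'] [IsScalarTower k k' l']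
    [Algebra.WeaklyEtale k l] [Algebra.WeaklyEtale k' l'] (hk : (p : k) = 0)
    (σ : k' ≃+* k) (hσ : ∀ x, σ (algebraMap k k' x) = x ^ p)
    (τ : l' ≃+* l) (hτ : ∀ x, τ (algebraMap l l' x) = x ^ p)
    (hστ : ∀ x, τ (algebraMap k' l' x) = algebraMap k l (σ x)) :
    Function.Bijective
      (Algebra.TensorProduct.productLeftAlgHom (Algebra.ofId k' l')
        (IsScalarTower.toAlgHom k l l')) := by
  let e := Algebra.TensorProduct.productLeftAlgHom (Algebra.ofId k' l')
        (IsScalarTower.toAlgHom k l l')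
  let := e.toRingHom.toAlgebra
  have : IsScalarTower k' (k' ⊗[k] l) l' := IsScalarTower.of_algebraMap_eq fun x =>
    (e.commutes x).symm
  have hk' : (p : k') = 0 := by rw [← map_natCast (algebraMap k k'), hk, map_zero]
  refine bijective_of_weaklyEtale_of_pow_mem_range (k := k') (T := k' ⊗[k] l) (S := l') hk' ?_ ?_
  · intro x
    refine ⟨1 ⊗ₜ τ x, ?_⟩
    apply τ.injective
    change τ (e _) = _
    simp [e, hτ]
  -- Since `b ^ p` is the image of `σ b`, it crosses the tensor sign. The formula shows that the
  -- kernel of `e` is killed by the `p`-th power.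
  · have key : ∀ x : k' ⊗[k] l, x ^ p = 1 ⊗ₜ τ (e x) := by
      refine tmul_sum_pow hk (fun x y => y = 1 ⊗ₜ τ (e x)) ?_ ?_ ?_
      · simp
      · intro b c
        have : b ^ p = algebraMap k k' (σ b) := σ.injective (by rw [hσ, map_pow])
        rw [this, Algebra.algebraMap_eq_smul_one, TensorProduct.smul_tmul]
        simp [e, hστ, hτ, Algebra.smul_def]
      · intro x y x' y' hx hy
        simp only [hx, hy, map_add, TensorProduct.tmul_add]
    intro x hx
    rw [key, show e x = 0 from hx, map_zero, TensorProduct.tmul_zero]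

/-- Over a ring of characteristic `p`, the base change to a weakly étale algebra of a bijective
Frobenius-semilinear map is bijective. -/
theorem exists_addEquiv_tensor {k : Type u} {l : Type v} [CommRing k] [CommRing l] [Algebra k l]
    [Algebra.WeaklyEtale k l] (hk : (p : k) = 0) {M N : Type*} [AddCommGroup M] [AddCommGroup N]
    [Module k M] [Module k N] (g : M ≃+ N) (hg : ∀ (r : k) m, g (r • m) = r ^ p • g m) :
    ∃ G : l ⊗[k] M ≃+ l ⊗[k] N, ∀ s m, G (s ⊗ₜ m) = (s ^ p) ⊗ₜ[k] g m := by
  obtain ⟨φ, hφ⟩ := exists_powRingHom (p := p) hk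
  obtain ⟨ψ, hψ⟩ := exists_powRingHom (p := p) (k := l)
    (by rw [← map_natCast (algebraMap k l), hk, map_zero])
  obtain ⟨k', l', _, _, _, _, σ, τ, hστ⟩ := exists_ulift_weaklyEtale k l
  let : Algebra k k' := ((σ.symm : k →+* k').comp φ).toAlgebra
  let : Algebra l l' := ((τ.symm : l →+* l').comp ψ).toAlgebra
  let : Algebra k l' := ((algebraMap l l').comp (algebraMap k l)).toAlgebra
  have hσ : ∀ x, σ (algebraMap k k' x) = x ^ p := fun x => by
    change σ (σ.symm (φ x)) = _
    rw [σ.apply_symm_apply, hφ]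
  have hτ : ∀ x, τ (algebraMap l l' x) = x ^ p := fun x => by
    change τ (τ.symm (ψ x)) = _
    rw [τ.apply_symm_apply, hψ]
  have : IsScalarTower k l l' := IsScalarTower.of_algebraMap_eq fun _ => rfl
  have : IsScalarTower k k' l' := IsScalarTower.of_algebraMap_eq fun x => τ.injective (by
    rw [hστ, hσ, map_pow, ← hτ]
    rfl)
  -- The action of `k'` is pulled back from `N` along `g` and `σ`; by semilinearity its restriction
  -- along `k → k'`, which is Frobenius, is the given action of `k`.
  let : Module k' M :=
    { smul := fun r m => g.symm (σ r • g m)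
      one_smul := fun m => by change g.symm (σ 1 • g m) = m; simp
      mul_smul := fun r s m => by
        change g.symm (σ (r * s) • g m) = g.symm (σ r • g (g.symm (σ s • g m)))
        simp [mul_smul]
      smul_zero := fun r => by change g.symm (σ r • g 0) = 0; simp
      smul_add := fun r m n => by
        change g.symm (σ r • g (m + n)) = g.symm (σ r • g m) + g.symm (σ r • g n)
        simp
      add_smul := fun r s m => by
        change g.symm (σ (r + s) • g m) = g.symm (σ r • g m) + g.symm (σ s • g m)
        simp [add_smul]
      zero_smul := fun m => by change g.symm (σ 0 • g m) = 0; simp }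
  have hg' : ∀ (r : k') m, g (r • m) = σ r • g m := fun r m => g.apply_symm_apply _
  have : IsScalarTower k k' M := IsScalarTower.of_algebraMap_smul fun r m => g.injective (by
    rw [hg', hσ, hg])
  exact exists_addEquiv_tensor_of_relativeFrobenius
    (relativeFrobenius_bijective hk σ hσ τ hτ hστ) σ τ hτ hστ g hg'

/-- The base change of an `R / I`-module along `R → S`, computed over `R / I`. -/
noncomputable def tensorQuotientEquiv {R : Type*} [CommRing R] (I : Ideal R) (S M : Type*)
    [CommRing S] [Algebra R S] [AddCommGroup M] [Module R M] [Module (R ⧸ I) M]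
    [IsScalarTower R (R ⧸ I) M] : S ⊗[R] M ≃ₗ[R] ((R ⧸ I) ⊗[R] S) ⊗[R ⧸ I] M :=
  TensorProduct.comm R S M ≪≫ₗ
    ((TensorProduct.AlgebraTensorModule.cancelBaseChange R (R ⧸ I) (R ⧸ I) M S).symm ≪≫ₗ
      TensorProduct.comm (R ⧸ I) M _).restrictScalars R

theorem tensorQuotientEquiv_tmul {R S M : Type*} [CommRing R] (I : Ideal R)
    [CommRing S] [Algebra R S] [AddCommGroup M] [Module R M] [Module (R ⧸ I) M]
    [IsScalarTower R (R ⧸ I) M] (s : S) (m : M) :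
    tensorQuotientEquiv I S M (s ⊗ₜ m) = (1 ⊗ₜ s) ⊗ₜ m := by
  simp [tensorQuotientEquiv]

variable {R : Type*} [CommRing R] {I : Ideal R} (S : Type*) [CommRing S] [Algebra R S]
  [Algebra.WeaklyEtale R S]

/-- The base change to a weakly étale algebra of a bijective Frobenius-semilinear map between
modules killed by an ideal containing `p` is bijective. -/
theorem exists_addEquiv_tensor_of_smul_eq_zero (hI : (p : R) ∈ I) {M N : Type*} [AddCommGroup M]
    [AddCommGroup N] [Module R M] [Module R N] (hM : ∀ r ∈ I, ∀ m : M, r • m = 0)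
    (hN : ∀ r ∈ I, ∀ m : N, r • m = 0)
    (g : M ≃+ N) (hg : ∀ (r : R) m, g (r • m) = r ^ p • g m) :
    ∃ G : S ⊗[R] M ≃+ S ⊗[R] N, ∀ s m, G (s ⊗ₜ m) = (s ^ p) ⊗ₜ[R] g m := by
  have hM' : Module.IsTorsionBySet R M I := fun m r => hM r r.2 m
  have hN' : Module.IsTorsionBySet R N I := fun m r => hN r r.2 m
  let := hM'.module
  let := hN'.module
  have : IsScalarTower R (R ⧸ I) M := hM'.isScalarTower
  have : IsScalarTower R (R ⧸ I) N := hN'.isScalarTower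
  -- Both modules live over `R ⧸ I`, which has characteristic `p`, and weak étaleness passes to the
  -- base change of `S`.
  obtain ⟨G, hG⟩ := exists_addEquiv_tensor (p := p) (k := R ⧸ I) (l := (R ⧸ I) ⊗[R] S)
    (by rw [← map_natCast (Ideal.Quotient.mk I)]; exact Ideal.Quotient.eq_zero_iff_mem.mpr hI)
    g (fun r m => by
      obtain ⟨r, rfl⟩ := Ideal.Quotient.mk_surjective r
      rw [← map_pow]
      exact hg r m)
  refine ⟨(tensorQuotientEquiv I S M).toAddEquiv.trans
    (G.trans (tensorQuotientEquiv I S N).symm.toAddEquiv), fun s m => ?_⟩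
  change (tensorQuotientEquiv I S N).symm (G (tensorQuotientEquiv I S M (s ⊗ₜ m))) = _
  rw [LinearEquiv.symm_apply_eq, tensorQuotientEquiv_tmul, hG, tensorQuotientEquiv_tmul,
    Algebra.TensorProduct.tmul_pow, one_pow]

end FrobeniusSemilinear

/-! ### Reductions modulo `I₀` and their Frobenius projections -/

section BaseChangeQuotient

variable {R : Type*} [CommRing R] {A : ℕ → Type*} [∀ i, CommRing (A i)] [∀ i, Algebra R (A i)]
  (S : Type*) [CommRing S] [Algebra R S] (I : Ideal R)

theorem levelIdeal_baseChange (i : ℕ) :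
    levelIdeal (fun i => S ⊗[R] A i) (I.map (algebraMap R S)) i =
      (levelIdeal A I i).map (toBaseChange S A i) := by
  rw [levelIdeal, levelIdeal, Ideal.map_map, Ideal.map_map]
  congr 1
  ext r
  simp [toBaseChange, Algebra.algebraMap_eq_smul_one]

/-- The canonical map `S ⊗ R_i → S ⊗ (R_i / I₀ R_i)`. -/
def tensorLevelQuotMap (A : ℕ → Type*) [∀ i, CommRing (A i)] [∀ i, Algebra R (A i)] (i : ℕ) :
    S ⊗[R] A i →ₐ[S] S ⊗[R] LevelQuot A I i :=
  Algebra.TensorProduct.map (AlgHom.id S S) (Ideal.Quotient.mkₐ R (levelIdeal A I i))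

theorem tensorLevelQuotMap_surjective (i : ℕ) :
    Function.Surjective (tensorLevelQuotMap S I A i) :=
  LinearMap.lTensor_surjective S (g := (Ideal.Quotient.mkₐ R (levelIdeal A I i)).toLinearMap)
    Ideal.Quotient.mk_surjective

theorem ker_tensorLevelQuotMap (i : ℕ) :
    RingHom.ker (tensorLevelQuotMap S I A i) =
      levelIdeal (fun i => S ⊗[R] A i) (I.map (algebraMap R S)) i := by
  have h := Algebra.TensorProduct.lTensor_ker (A := S)
    (Ideal.Quotient.mkₐ R (levelIdeal A I i)) Ideal.Quotient.mk_surjective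
  rw [show RingHom.ker (Ideal.Quotient.mkₐ R (levelIdeal A I i)) = _ from Ideal.mk_ker] at h
  exact h.trans (levelIdeal_baseChange S I i).symm

/-- The isomorphism `S ⊗ (R_i / I₀ R_i) ≃ S_i / I₀ S_i`. -/
noncomputable def tensorLevelQuotEquiv (A : ℕ → Type*) [∀ i, CommRing (A i)]
    [∀ i, Algebra R (A i)] (i : ℕ) : S ⊗[R] LevelQuot A I i ≃+*
      LevelQuot (fun i => S ⊗[R] A i) (I.map (algebraMap R S)) i :=
  (RingHom.quotientKerEquivOfSurjective (tensorLevelQuotMap_surjective (A := A) S I i)).symm.trans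
    (Ideal.quotEquivOfEq (ker_tensorLevelQuotMap S I i))

theorem tensorLevelQuotEquiv_map (i : ℕ) (z : S ⊗[R] A i) :
    tensorLevelQuotEquiv S I A i (tensorLevelQuotMap S I A i z) = Ideal.Quotient.mk _ z := by
  have : (RingHom.quotientKerEquivOfSurjective (tensorLevelQuotMap_surjective (A := A) S I i)).symm
      (tensorLevelQuotMap S I A i z) = Ideal.Quotient.mk _ z := by
    rw [RingEquiv.symm_apply_eq]
    rfl
  rw [tensorLevelQuotEquiv, RingEquiv.trans_apply]
  erw [this]
  rfl

theorem tensorLevelQuotEquiv_tmul_mk (i : ℕ) (s : S) (a : A i) :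
    tensorLevelQuotEquiv S I A i (s ⊗ₜ Ideal.Quotient.mk _ a) = Ideal.Quotient.mk _ (s ⊗ₜ a) :=
  tensorLevelQuotEquiv_map S I i (s ⊗ₜ a)

/-- The map `R_i / I₀ R_i → S_i / I₀ S_i`. -/
def levelQuotToBaseChange (A : ℕ → Type*) [∀ i, CommRing (A i)] [∀ i, Algebra R (A i)] (i : ℕ) :
    LevelQuot A I i →+* LevelQuot (fun i => S ⊗[R] A i) (I.map (algebraMap R S)) i :=
  Ideal.quotientMap _ (toBaseChange S A i) (levelIdeal_le_comap_toBaseChange S I i)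

theorem tensorLevelQuotEquiv_one_tmul (i : ℕ) (x : LevelQuot A I i) :
    tensorLevelQuotEquiv S I A i (1 ⊗ₜ x) = levelQuotToBaseChange S I A i x := by
  obtain ⟨a, rfl⟩ := Ideal.Quotient.mk_surjective x
  rw [tensorLevelQuotEquiv_tmul_mk]
  rfl

variable {I} (t : ∀ i, A i →ₐ[R] A (i + 1))

theorem tbar_tensorLevelQuotEquiv (i : ℕ) (s : S) (x : LevelQuot A I i) :
    tbar (I.map (algebraMap R S)) (baseChange S t) i (tensorLevelQuotEquiv S I A i (s ⊗ₜ x)) =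
      tensorLevelQuotEquiv S I A (i + 1) (s ⊗ₜ tbar I t i x) := by
  obtain ⟨a, rfl⟩ := Ideal.Quotient.mk_surjective x
  rw [tensorLevelQuotEquiv_tmul_mk, tbar, tbar, Ideal.quotientMap_mk, Ideal.quotientMap_mk,
    tensorLevelQuotEquiv_tmul_mk]
  rfl

variable {S t} {p : ℕ} [hp : Fact p.Prime]

/-- Flatness suffices here: it preserves injectivity modulo `I₀`, and the Frobenius condition is
additive, so pure tensors decide it. -/
theorem IsPurelyInseparable.baseChange [Module.Flat R S] (h : IsPurelyInseparable p I t) :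
    IsPurelyInseparable p (I.map (algebraMap R S)) (baseChange S t) where
  base := by
    let e : R ≃ₐ[R] A 0 := AlgEquiv.ofBijective (Algebra.ofId R (A 0)) h.base
    let E : S ≃ₐ[S] S ⊗[R] A 0 := (Algebra.TensorProduct.rid R S S).symm.trans
      (Algebra.TensorProduct.congr AlgEquiv.refl e)
    convert E.bijective using 1
    ext s
    simp [E]
  p_mem := by
    rw [← map_natCast (algebraMap R S)]
    exact Ideal.mem_map_of_mem _ h.p_mem
  injective i := by
    let T : LevelQuot A I i →ₗ[R] LevelQuot A I (i + 1) :=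
      { (tbar I t i).toAddMonoidHom with
        map_smul' := fun r x => by
          change tbar I t i (r • x) = r • tbar I t i x
          rw [Algebra.smul_def, Algebra.smul_def, map_mul]
          congr 1
          exact congrArg (Ideal.Quotient.mk _) ((t i).commutes r) }
    have hT := Module.Flat.lTensor_preserves_injective_linearMap (M := S) T (h.injective i)
    have key : ∀ z, tbar (I.map (algebraMap R S)) (PerfectoidTower.baseChange S t) i
        (tensorLevelQuotEquiv S I A i z) =
          tensorLevelQuotEquiv S I A (i + 1) (T.lTensor S z) := by
      intro z
      induction z with
      | zero => simp only [map_zero]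
      | tmul s x => exact tbar_tensorLevelQuotEquiv S t i s x
      | add x y hx hy => simp only [map_add, hx, hy]
    intro x y hxy
    obtain ⟨x, rfl⟩ := (tensorLevelQuotEquiv S I A i).surjective x
    obtain ⟨y, rfl⟩ := (tensorLevelQuotEquiv S I A i).surjective y
    rw [key, key] at hxy
    rw [hT ((tensorLevelQuotEquiv S I A (i + 1)).injective hxy)]
  frobenius_mem i x := by
    have hpI : (p : S) ∈ I.map (algebraMap R S) := by
      rw [← map_natCast (algebraMap R S)]
      exact Ideal.mem_map_of_mem _ h.p_mem
    obtain ⟨σ, hσ⟩ := exists_powRingHom (p := p)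
      (natCast_levelQuot (A := fun i => S ⊗[R] A i) hpI (i + 1))
    obtain ⟨z, rfl⟩ := (tensorLevelQuotEquiv S I A (i + 1)).surjective x
    rw [← hσ]
    induction z with
    | zero => simp only [map_zero]; exact zero_mem _
    | tmul s x =>
      obtain ⟨y, hy⟩ := h.frobenius_mem i x
      refine ⟨tensorLevelQuotEquiv S I A i ((s ^ p) ⊗ₜ y), ?_⟩
      rw [tbar_tensorLevelQuotEquiv, hy, hσ, ← map_pow, Algebra.TensorProduct.tmul_pow]
    | add x y hx hy => simp only [map_add]; exact add_mem hx hy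

/-- Both sides have the same image, the `p`-th power of `s ⊗ x`, under the injective transition map.
-/
theorem frobeniusProjection_tensorLevelQuotEquiv (h : IsPurelyInseparable p I t)
    (h' : IsPurelyInseparable p (I.map (algebraMap R S)) (PerfectoidTower.baseChange S t)) (i : ℕ)
    (s : S) (x : LevelQuot A I (i + 1)) :
    frobeniusProjection h' i (tensorLevelQuotEquiv S I A (i + 1) (s ⊗ₜ x)) =
      tensorLevelQuotEquiv S I A i ((s ^ p) ⊗ₜ frobeniusProjection h i x) := by
  refine h'.injective i ?_
  rw [tbar_frobeniusProjection, tbar_tensorLevelQuotEquiv, tbar_frobeniusProjection, ← map_pow,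
    Algebra.TensorProduct.tmul_pow]

theorem frobeniusProjection_smul (h : IsPurelyInseparable p I t) (i : ℕ) (r : R)
    (x : LevelQuot A I (i + 1)) :
    frobeniusProjection h i (r • x) = r ^ p • frobeniusProjection h i x := by
  refine h.injective i ?_
  rw [tbar_frobeniusProjection, Algebra.smul_def, Algebra.smul_def, map_mul, mul_pow,
    tbar_frobeniusProjection]
  congr 1
  rw [← map_pow]
  exact congrArg (Ideal.Quotient.mk _) ((t i).commutes (r ^ p)).symm

theorem smul_levelQuot_eq_zero {i : ℕ} {r : R} (hr : r ∈ I) (x : LevelQuot A I i) : r • x = 0 := by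
  have : algebraMap R (LevelQuot A I i) r = 0 :=
    Ideal.Quotient.eq_zero_iff_mem.mpr (Ideal.mem_map_of_mem _ hr)
  rw [Algebra.smul_def, this, zero_mul]

variable [Algebra.WeaklyEtale R S]

/-- The semilinear bijection from `X ⧸ ker F` to `Y` base changes to a bijection `G`, and `Φ` is the
base-changed quotient map followed by `G` and `e`. Thus surjectivity and kernel are those of the
quotient map, known by right exactness. -/
theorem surjective_and_ker_of_tmul_pow {X Y Z : Type*} [CommRing X] [CommRing Y] [CommRing Z]
    [Algebra R X] [Algebra R Y] (hpI : (p : R) ∈ I) (hX : ∀ r ∈ I, ∀ m : X, r • m = 0)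
    (hY : ∀ r ∈ I, ∀ m : Y, r • m = 0) (F : X →+* Y) (hF : Function.Surjective F)
    (hsmul : ∀ (r : R) x, F (r • x) = r ^ p • F x) (e : S ⊗[R] Y ≃+* Z) (Φ : S ⊗[R] X →+* Z)
    (hΦ : ∀ s x, Φ (s ⊗ₜ x) = e ((s ^ p) ⊗ₜ F x)) :
    Function.Surjective Φ ∧ RingHom.ker Φ =
      (RingHom.ker F).map (Algebra.TensorProduct.includeRight : X →ₐ[R] S ⊗[R] X) := by
  have hK : ∀ r ∈ I, ∀ m : X ⧸ RingHom.ker F, r • m = 0 := by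
    intro r hr m
    obtain ⟨m, rfl⟩ := Ideal.Quotient.mk_surjective m
    change Ideal.Quotient.mk _ (r • m) = 0
    rw [hX r hr, map_zero]
  obtain ⟨G, hG⟩ := exists_addEquiv_tensor_of_smul_eq_zero S hpI hK hY
    (RingHom.quotientKerEquivOfSurjective hF).toAddEquiv (fun r m => by
      obtain ⟨m, rfl⟩ := Ideal.Quotient.mk_surjective m
      exact hsmul r m)
  let q : S ⊗[R] X →ₐ[R] S ⊗[R] (X ⧸ RingHom.ker F) :=
    Algebra.TensorProduct.map (AlgHom.id R S) (Ideal.Quotient.mkₐ R (RingHom.ker F))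
  have hq : Function.Surjective q := LinearMap.lTensor_surjective S
    (g := (Ideal.Quotient.mkₐ R (RingHom.ker F)).toLinearMap) Ideal.Quotient.mk_surjective
  have key : ∀ z, Φ z = e (G (q z)) := by
    intro z
    induction z with
    | zero => rw [map_zero, map_zero, G.map_zero, map_zero]
    | tmul s x => rw [hΦ, Algebra.TensorProduct.map_tmul, hG]; rfl
    | add x y hx hy => rw [map_add, hx, hy, map_add, G.map_add, map_add]
  constructor
  · intro y
    obtain ⟨z, hz⟩ := hq (G.symm (e.symm y))
    exact ⟨z, by rw [key, hz, G.apply_symm_apply, e.apply_symm_apply]⟩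
  · have h1 := Algebra.TensorProduct.lTensor_ker (A := S)
      (Ideal.Quotient.mkₐ R (RingHom.ker F)) Ideal.Quotient.mk_surjective
    rw [show RingHom.ker (Ideal.Quotient.mkₐ R (RingHom.ker F)) = _ from Ideal.mk_ker] at h1
    rw [← h1]
    ext z
    rw [RingHom.mem_ker, RingHom.mem_ker, key, map_eq_zero_iff e e.injective,
      map_eq_zero_iff G G.injective]

theorem surjective_and_ker_of_ringEquiv_tmul_pow {X Y Z W : Type*} [CommRing X] [CommRing Y] [CommRing Z]
    [CommRing W] [Algebra R X] [Algebra R Y] (hpI : (p : R) ∈ I)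
    (hX : ∀ r ∈ I, ∀ m : X, r • m = 0) (hY : ∀ r ∈ I, ∀ m : Y, r • m = 0) (F : X →+* Y)
    (hF : Function.Surjective F) (hsmul : ∀ (r : R) x, F (r • x) = r ^ p • F x)
    (e : S ⊗[R] Y ≃+* Z) (ε : S ⊗[R] X ≃+* W) (Φ : W →+* Z)
    (hΦ : ∀ s x, Φ (ε (s ⊗ₜ x)) = e ((s ^ p) ⊗ₜ F x)) (ι : X →+* W) (hι : ∀ x, ε (1 ⊗ₜ x) = ι x) :
    Function.Surjective Φ ∧ RingHom.ker Φ = (RingHom.ker F).map ι := by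
  obtain ⟨h1, h2⟩ := surjective_and_ker_of_tmul_pow hpI hX hY F hF hsmul e
    (Φ.comp (ε : S ⊗[R] X →+* W)) hΦ
  refine ⟨fun y => ?_, ?_⟩
  · obtain ⟨z, hz⟩ := h1 y
    exact ⟨ε z, hz⟩
  · have h3 : ι = (ε : S ⊗[R] X →+* W).comp
        (Algebra.TensorProduct.includeRight : X →ₐ[R] S ⊗[R] X).toRingHom :=
      RingHom.ext fun x => (hι x).symm
    rw [h3, ← Ideal.map_map]
    refine Eq.trans ?_ (congrArg (Ideal.map (ε : S ⊗[R] X →+* W)) h2)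
    rw [← RingHom.comap_ker, Ideal.map_comap_of_surjective (ε : S ⊗[R] X →+* W) ε.surjective]

theorem frobeniusProjection_baseChange (h : IsPurelyInseparable p I t)
    (h' : IsPurelyInseparable p (I.map (algebraMap R S)) (PerfectoidTower.baseChange S t)) (i : ℕ)
    (hF : Function.Surjective (frobeniusProjection h i)) :
    Function.Surjective (frobeniusProjection h' i) ∧ RingHom.ker (frobeniusProjection h' i) =
      (RingHom.ker (frobeniusProjection h i)).map (levelQuotToBaseChange S I A (i + 1)) :=
  surjective_and_ker_of_ringEquiv_tmul_pow h.p_mem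
    (fun _ hr => smul_levelQuot_eq_zero (A := A) (i := i + 1) hr)
    (fun _ hr => smul_levelQuot_eq_zero (A := A) (i := i) hr) _ hF
    (frobeniusProjection_smul h i) (tensorLevelQuotEquiv S I A i)
    (tensorLevelQuotEquiv S I A (i + 1)) (frobeniusProjection h' i)
    (frobeniusProjection_tensorLevelQuotEquiv h h' i) _ (tensorLevelQuotEquiv_one_tmul S I (i + 1))

end BaseChangeQuotient

/-! ### Base change of torsion, of the tower axioms and of pillars -/

section BaseChangePreperfectoid

variable {R : Type*} [CommRing R] {A : ℕ → Type*} [∀ i, CommRing (A i)] [∀ i, Algebra R (A i)]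
  {S : Type*} [CommRing S] [Algebra R S] {I : Ideal R}
  {t : ∀ i, A i →ₐ[R] A (i + 1)} {p : ℕ} [hp : Fact p.Prime]

theorem transitionFromOne_toBaseChange (i : ℕ) (x : A 1) :
    toBaseChange S A (i + 1) (transitionFromOne t i x) =
      transitionFromOne (baseChange S t) i (toBaseChange S A 1 x) := by
  induction i with
  | zero => rfl
  | succ i ih =>
    exact (toBaseChange_comm S t (i + 1) _).trans (congrArg _ ih)

theorem map_map_map_eq {B C D B' C' D' : Type*} [CommRing B] [CommRing C] [CommRing D]
    [CommRing B'] [CommRing C'] [CommRing D'] (f : B →+* C) (q : C →+* D) (ι : D →+* D')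
    (j : B →+* B') (f' : B' →+* C') (q' : C' →+* D') (h : ∀ x, ι (q (f x)) = q' (f' (j x)))
    (J : Ideal B) : ((J.map f).map q).map ι = ((J.map j).map f').map q' := by
  rw [Ideal.map_map, Ideal.map_map, Ideal.map_map, Ideal.map_map]
  congr 1
  exact RingHom.ext h

theorem IsFirstPillar.baseChange [Algebra.WeaklyEtale R S] {h : IsPurelyInseparable p I t}
    (h' : IsPurelyInseparable p (I.map (algebraMap R S)) (baseChange S t))
    (hF : ∀ i, Function.Surjective (frobeniusProjection h i)) {J : Ideal (A 1)}
    (hJ : IsFirstPillar h J) : IsFirstPillar h' (J.map (toBaseChange S A 1)) where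
  principal := by
    obtain ⟨c, rfl⟩ := hJ.principal
    refine ⟨toBaseChange S A 1 c, ?_⟩
    rw [← Ideal.span, Ideal.map_span, Set.image_singleton]
  pow_eq := by
    rw [← Ideal.map_pow, hJ.pow_eq, levelIdeal_baseChange]
  ker_eq i := by
    rw [(frobeniusProjection_baseChange h h' i (hF i)).2, hJ.ker_eq i]
    exact map_map_map_eq (transitionFromOne t i : A 1 →+* A (i + 1)) _
      (levelQuotToBaseChange S I A (i + 1)) (toBaseChange S A 1)
      (transitionFromOne (PerfectoidTower.baseChange S t) i : S ⊗[R] A 1 →+* S ⊗[R] A (i + 1)) _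
      (fun x => congrArg (Ideal.Quotient.mk _) (transitionFromOne_toBaseChange i x)) J

theorem mem_idealTorsion_span_singleton {a : R} {M : Type*} [AddCommGroup M] [Module R M] {x : M} :
    x ∈ idealTorsion (Ideal.span {a}) M ↔ ∃ n : ℕ, 0 < n ∧ a ^ n • x = 0 := by
  refine ⟨fun h => h a (Ideal.mem_span_singleton_self a), ?_⟩
  rintro ⟨n, hn, hx⟩ b hb
  obtain ⟨c, rfl⟩ := Ideal.mem_span_singleton.mp hb
  exact ⟨n, hn, by rw [mul_comm, mul_pow, mul_smul, hx, smul_zero]⟩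

theorem mem_idealTorsion_iff {a : R} {M : Type*} [AddCommGroup M] [Module R M]
    (h : Ideal.span {a} • idealTorsion (Ideal.span {a}) M = ⊥) {x : M} :
    x ∈ idealTorsion (Ideal.span {a}) M ↔ a • x = 0 := by
  refine ⟨fun hx => ?_, fun hx => mem_idealTorsion_span_singleton.mpr ⟨1, one_pos, by simpa⟩⟩
  have := Submodule.smul_mem_smul (Ideal.mem_span_singleton_self a) hx
  rwa [h, Submodule.mem_bot] at this

/-- The `a`-power torsion of a flat base change is the base change of the `a`-power torsion. -/
theorem mem_idealTorsion_tensor_iff [Module.Flat R S] {a : R} {M : Type*} [AddCommGroup M]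
    [Module R M] (h : Ideal.span {a} • idealTorsion (Ideal.span {a}) M = ⊥) {z : S ⊗[R] M} :
    z ∈ idealTorsion ((Ideal.span {a}).map (algebraMap R S)) (S ⊗[R] M) ↔
      z ∈ LinearMap.range ((idealTorsion (Ideal.span {a}) M).subtype.lTensor S) := by
  rw [Ideal.map_span, Set.image_singleton, mem_idealTorsion_span_singleton]
  constructor
  · rintro ⟨n, hn, hz⟩
    rw [← map_pow, algebraMap_smul] at hz
    -- Every positive power of `a` has the same kernel, namely the torsion, and flatness preserves
    -- this exactness.
    have hex : Function.Exact (idealTorsion (Ideal.span {a}) M).subtype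
        (LinearMap.lsmul R M (a ^ n)) := by
      intro x
      rw [LinearMap.lsmul_apply]
      constructor
      · intro hx
        exact ⟨⟨x, mem_idealTorsion_span_singleton.mpr ⟨n, hn, hx⟩⟩, rfl⟩
      · rintro ⟨⟨y, hy⟩, rfl⟩
        obtain ⟨m, rfl⟩ : ∃ m, n = m + 1 := ⟨n - 1, by omega⟩
        change a ^ (m + 1) • y = 0
        rw [pow_succ, mul_smul, (mem_idealTorsion_iff h).mp hy, smul_zero]
    refine (Module.Flat.lTensor_exact S hex z).mp ?_
    rw [← hz]
    clear hz
    induction z with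
    | zero => simp
    | tmul s x => simp
    | add x y hx hy => rw [map_add, hx, hy, smul_add]
  · rintro ⟨w, rfl⟩
    refine ⟨1, one_pos, ?_⟩
    rw [pow_one, algebraMap_smul]
    induction w with
    | zero => simp
    | tmul s x =>
      rw [LinearMap.lTensor_tmul, ← TensorProduct.tmul_smul]
      change s ⊗ₜ (a • (x : M)) = 0
      rw [(mem_idealTorsion_iff h).mp x.2, TensorProduct.tmul_zero]
    | add x y hx hy => rw [map_add, smul_add, hx, hy, add_zero]

theorem smul_idealTorsion_tensor [Module.Flat R S] {a : R} {M : Type*} [AddCommGroup M]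
    [Module R M] (h : Ideal.span {a} • idealTorsion (Ideal.span {a}) M = ⊥) :
    (Ideal.span {a}).map (algebraMap R S) •
      idealTorsion ((Ideal.span {a}).map (algebraMap R S)) (S ⊗[R] M) = ⊥ := by
  rw [eq_bot_iff, Submodule.smul_le]
  intro r hr z hz
  obtain ⟨w, rfl⟩ := (mem_idealTorsion_tensor_iff h).mp hz
  rw [Ideal.map_span, Set.image_singleton] at hr
  obtain ⟨c, rfl⟩ := Ideal.mem_span_singleton.mp hr
  rw [Submodule.mem_bot, mul_comm, mul_smul, algebraMap_smul]
  clear hz hr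
  induction w with
  | zero => simp
  | tmul s x =>
    rw [LinearMap.lTensor_tmul, ← TensorProduct.tmul_smul]
    change c • s ⊗ₜ (a • (x : M)) = 0
    rw [(mem_idealTorsion_iff h).mp x.2, TensorProduct.tmul_zero, smul_zero]
  | add x y hx hy => rw [map_add, smul_add, smul_add, hx, hy, add_zero]

/-- The torsion embeds into `R_i / I₀ R_i`. -/
theorem eq_of_mk_eq_of_mem_idealTorsion {i : ℕ} (hI : I.IsPrincipal)
    (h : I • idealTorsion I (A i) = ⊥) {x y : A i}
    (hx : x ∈ idealTorsion I (A i)) (hy : y ∈ idealTorsion I (A i))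
    (hxy : Ideal.Quotient.mk (levelIdeal A I i) x = Ideal.Quotient.mk (levelIdeal A I i) y) :
    x = y := by
  obtain ⟨a, rfl⟩ := hI
  rw [← Ideal.span] at *
  rw [Ideal.Quotient.eq, levelIdeal, Ideal.map_span, Set.image_singleton,
    Ideal.mem_span_singleton] at hxy
  obtain ⟨z, hz⟩ := hxy
  rw [← Algebra.smul_def] at hz
  -- With `x - y = a • z` torsion, `a` kills it, so `a ^ 2 • z = 0`; then `z` is torsion and already
  -- `a • z = 0`.
  have h1 : z ∈ idealTorsion (Ideal.span {a}) (A i) := by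
    refine mem_idealTorsion_span_singleton.mpr ⟨2, two_pos, ?_⟩
    rw [pow_two, mul_smul, ← hz]
    exact (mem_idealTorsion_iff h).mp (sub_mem hx hy)
  rw [(mem_idealTorsion_iff h).mp h1] at hz
  exact sub_eq_zero.mp hz

/-- Condition (g) only provides a bijection of sets. Additivity and semilinearity are inherited from
`F_i`, because torsion embeds into `R_i / I₀ R_i`. -/
theorem exists_torsionEquiv (h : IsPreperfectoid p I t) (i : ℕ) :
    ∃ f : idealTorsion I (A (i + 1)) ≃+ idealTorsion I (A i),
      (∀ (r : R) x, f (r • x) = r ^ p • f x) ∧ ∀ x : idealTorsion I (A (i + 1)),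
      Ideal.Quotient.mk (levelIdeal A I i) (f x : A i) =
        frobeniusProjection h.insep i
          (Ideal.Quotient.mk (levelIdeal A I (i + 1)) (x : A (i + 1))) := by
  obtain ⟨f, hf, hfF⟩ := h.exists_torsionMap i
  have hinj : ∀ x y : idealTorsion I (A i), Ideal.Quotient.mk (levelIdeal A I i) (x : A i) =
      Ideal.Quotient.mk (levelIdeal A I i) (y : A i) → x = y := fun x y hxy =>
    Subtype.ext (eq_of_mk_eq_of_mem_idealTorsion h.principal (h.smul_torsion i) x.2 y.2 hxy)
  refine ⟨{ Equiv.ofBijective f hf with map_add' := fun x y => ?_ }, fun r x => ?_, hfF⟩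
  · refine hinj _ _ ?_
    change Ideal.Quotient.mk _ (f (x + y) : A i) = Ideal.Quotient.mk _ ((f x : A i) + f y)
    rw [hfF, map_add, hfF, hfF, ← map_add, ← map_add]
    rfl
  · refine hinj _ _ ?_
    have h1 := frobeniusProjection_smul h.insep i r
      (Ideal.Quotient.mk (levelIdeal A I (i + 1)) (x : A (i + 1)))
    rw [← hfF] at h1
    exact (hfF (r • x)).trans h1

theorem IsPreperfectoid.baseChange [Algebra.WeaklyEtale R S] (h : IsPreperfectoid p I t) :
    IsPreperfectoid p (I.map (algebraMap R S)) (baseChange S t) where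
  insep := h.insep.baseChange
  surjective i :=
    (frobeniusProjection_baseChange h.insep h.insep.baseChange i (h.surjective i)).1
  principal := by
    obtain ⟨a, rfl⟩ := h.principal
    refine ⟨algebraMap R S a, ?_⟩
    rw [← Ideal.span, Ideal.map_span, Set.image_singleton]
  exists_firstPillar := by
    obtain ⟨J, hJ⟩ := h.exists_firstPillar
    exact ⟨_, hJ.baseChange h.insep.baseChange h.surjective⟩
  smul_torsion i := by
    have h1 := h.smul_torsion i
    obtain ⟨a, rfl⟩ := h.principal
    exact smul_idealTorsion_tensor h1
  exists_torsionMap i := by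
    obtain ⟨f, hf, hfF⟩ := exists_torsionEquiv h i
    have hkill : ∀ j, ∀ r ∈ I, ∀ x : idealTorsion I (A j), r • x = 0 := by
      intro j r hr x
      have := Submodule.smul_mem_smul hr x.2
      rw [h.smul_torsion j, Submodule.mem_bot] at this
      exact Subtype.ext this
    obtain ⟨G, hG⟩ := exists_addEquiv_tensor_of_smul_eq_zero S h.insep.p_mem (hkill (i + 1))
      (hkill i) f hf
    -- By flatness `S ⊗` torsion is the torsion of `S_j`; the new torsion map is `G` conjugated by
    -- these identifications.
    have hE : ∀ j, ∃ E : S ⊗[R] idealTorsion I (A j) ≃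
        idealTorsion (I.map (algebraMap R S)) (S ⊗[R] A j),
        ∀ z, (E z : S ⊗[R] A j) = (idealTorsion I (A j)).subtype.lTensor S z := by
      intro j
      have hmem : ∀ z, z ∈ idealTorsion (I.map (algebraMap R S)) (S ⊗[R] A j) ↔
          z ∈ LinearMap.range ((idealTorsion I (A j)).subtype.lTensor S) := by
        have h1 := h.smul_torsion j
        obtain ⟨a, rfl⟩ := h.principal
        exact fun z => mem_idealTorsion_tensor_iff h1
      refine ⟨Equiv.ofBijective (fun z => ⟨_, (hmem _).mpr ⟨z, rfl⟩⟩) ⟨fun z w hzw => ?_, ?_⟩,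
        fun z => rfl⟩
      · exact Module.Flat.lTensor_preserves_injective_linearMap (M := S) _
          (Submodule.injective_subtype _) (congrArg Subtype.val hzw)
      · rintro ⟨z, hz⟩
        obtain ⟨w, rfl⟩ := (hmem z).mp hz
        exact ⟨w, rfl⟩
    obtain ⟨E1, hE1⟩ := hE (i + 1)
    obtain ⟨E0, hE0⟩ := hE i
    refine ⟨E0 ∘ G ∘ E1.symm, E0.bijective.comp (G.bijective.comp E1.symm.bijective), fun x => ?_⟩
    obtain ⟨z, rfl⟩ := E1.surjective x
    rw [Function.comp_apply, Function.comp_apply, E1.symm_apply_apply, hE0, hE1]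
    induction z with
    | zero => simp only [map_zero]
    | tmul s x =>
      rw [hG, LinearMap.lTensor_tmul, LinearMap.lTensor_tmul]
      have h1 := frobeniusProjection_tensorLevelQuotEquiv (S := S) h.insep h.insep.baseChange i s
        (Ideal.Quotient.mk _ (x : A (i + 1)))
      rw [← hfF, tensorLevelQuotEquiv_tmul_mk, tensorLevelQuotEquiv_tmul_mk] at h1
      exact h1.symm
    | add x y hx hy => simp only [map_add, hx, hy]

theorem IsPillarSequence.baseChange [Algebra.WeaklyEtale R S] {h : IsPurelyInseparable p I t}
    (h' : IsPurelyInseparable p (I.map (algebraMap R S)) (baseChange S t))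
    (hF : ∀ i, Function.Surjective (frobeniusProjection h i)) {J : ∀ i, Ideal (A i)}
    (hJ : IsPillarSequence h J) :
    IsPillarSequence h' (fun i => (J i).map (toBaseChange S A i)) where
  zero := by rw [hJ.zero, levelIdeal_baseChange]
  one := hJ.one.baseChange h' hF
  fg i hi := (hJ.fg i hi).map _
  le i hi := by
    rw [levelIdeal_baseChange]
    exact Ideal.map_mono (hJ.le i hi)
  image_eq i := by
    have h1 : ∀ i, ((J i).map (toBaseChange S A i)).map (Ideal.Quotient.mk
        (levelIdeal (fun i => S ⊗[R] A i) (I.map (algebraMap R S)) i)) =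
        ((J i).map (Ideal.Quotient.mk (levelIdeal A I i))).map (levelQuotToBaseChange S I A i) := by
      intro i
      rw [Ideal.map_map, Ideal.map_map]
      rfl
    have h2 : ((J (i + 1)).map (Ideal.Quotient.mk (levelIdeal A I (i + 1)))).map
        (frobeniusProjection h i) = (J i).map (Ideal.Quotient.mk (levelIdeal A I i)) := by
      refine SetLike.ext fun x => ?_
      rw [Ideal.mem_map_iff_of_surjective _ (hF i), ← SetLike.mem_coe, ← hJ.image_eq i]
      rfl
    have h3 : (frobeniusProjection h' i).comp (levelQuotToBaseChange S I A (i + 1)) =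
        (levelQuotToBaseChange S I A i).comp (frobeniusProjection h i) :=
      RingHom.ext fun x => quotientMap_frobeniusProjection h h' (toBaseChange S A)
        (toBaseChange_comm S t) (levelIdeal_le_comap_toBaseChange S I) i x
    -- Under a surjection the image of an ideal is its extension, so the claim reduces to the
    -- Frobenius projections commuting with the maps to the base change.
    rw [h1, h1, ← h2, Ideal.map_map (I := Ideal.map _ (J (i + 1))) (frobeniusProjection h i),
      ← h3, ← Ideal.map_map]
    ext x
    exact (Ideal.mem_map_iff_of_surjective _ (frobeniusProjection_baseChange h h' i (hF i)).1).symm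

theorem pillar_baseChange [Algebra.WeaklyEtale R S] (h : IsPreperfectoid p I t)
    (h' : IsPreperfectoid p (I.map (algebraMap R S)) (baseChange S t)) (i : ℕ) :
    pillar h' i = (pillar h i).map (toBaseChange S A i) :=
  congrFun ((existsUnique_isPillarSequence h').unique (isPillarSequence_pillar h')
    ((isPillarSequence_pillar h).baseChange h'.insep h.surjective)) i

end BaseChangePreperfectoid

/-! ### Principal generators in the small tilts -/

section TiltGenerator

variable {R : Type*} [CommRing R] {A : ℕ → Type*} [∀ i, CommRing (A i)] [∀ i, Algebra R (A i)]
  {I : Ideal R} {t : ∀ i, A i →ₐ[R] A (i + 1)} {p : ℕ} [hp : Fact p.Prime]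

/-- A generator `c` of a first perfectoid pillar together with a system `f` of successive
preimages of its class under the Frobenius projections. -/
structure IsTiltGenerator (h : IsPurelyInseparable p I t) (c : A 1) (f : ∀ n, LevelQuot A I n) :
    Prop where
  firstPillar : IsFirstPillar h (Ideal.span {c})
  zero : f 0 = 0
  one : f 1 = Ideal.Quotient.mk _ c
  frobenius : ∀ n, frobeniusProjection h n (f (n + 1)) = f n

theorem exists_isTiltGenerator (h : IsPreperfectoid p I t) :
    ∃ c f, IsTiltGenerator h.insep c f := by
  obtain ⟨J, hJ⟩ := h.exists_firstPillar
  obtain ⟨c, rfl⟩ := hJ.principal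
  rw [← Ideal.span] at hJ
  let g : ∀ n, LevelQuot A I (n + 1) := fun n => Nat.rec (Ideal.Quotient.mk _ c)
    (fun n y => Function.surjInv (h.surjective (n + 1)) y) n
  -- Prepending `0` is consistent because the class of `c` lies in the kernel of `F_0`.
  let f : ∀ n, LevelQuot A I n := fun n => Nat.casesOn n 0 g
  refine ⟨c, f, hJ, rfl, rfl, fun n => ?_⟩
  cases n with
  | zero =>
    have h1 := hJ.ker_eq 0
    have h2 : Ideal.Quotient.mk (levelIdeal A I 1) c ∈
        RingHom.ker (frobeniusProjection h.insep 0) := by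
      rw [h1]
      exact Ideal.mem_map_of_mem _ (Ideal.mem_map_of_mem (transitionFromOne t 0)
        (Ideal.mem_span_singleton_self c))
    exact h2
  | succ n => exact Function.surjInv_eq (h.surjective (n + 1)) (g n)

namespace IsTiltGenerator

section

variable {h : IsPurelyInseparable p I t} {c : A 1} {f : ∀ n, LevelQuot A I n}

theorem pow_eq_tbar (hf : IsTiltGenerator h c f) (n : ℕ) : f (n + 1) ^ p = tbar I t n (f n) := by
  rw [← tbar_frobeniusProjection h, hf.frobenius]

theorem pow_succ_eq (hf : IsTiltGenerator h c f) (n : ℕ) : f (n + 1) ^ p ^ n = Ideal.Quotient.mk _ (transitionFromOne t n c) := by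
  induction n with
  | zero => rw [pow_zero, pow_one, hf.one]; rfl
  | succ n ih =>
    rw [pow_succ', pow_mul, hf.pow_eq_tbar, ← map_pow, ih]
    rfl

theorem pow_eq_zero (hf : IsTiltGenerator h c f) (n : ℕ) : f n ^ p ^ n = 0 := by
  induction n with
  | zero => rw [pow_zero, pow_one, hf.zero]
  | succ n ih => rw [pow_succ', pow_mul, hf.pow_eq_tbar, ← map_pow, ih, map_zero]

theorem ker_eq (hf : IsTiltGenerator h c f) (n : ℕ) :
    RingHom.ker (frobeniusProjection h n) = Ideal.span {f (n + 1) ^ p ^ n} := by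
  rw [hf.firstPillar.ker_eq, Ideal.map_span, Ideal.map_span, Set.image_singleton,
    Set.image_singleton, hf.pow_succ_eq]

theorem levelIdeal_succ (hf : IsTiltGenerator h c f) (n : ℕ) :
    levelIdeal A I (n + 1) = Ideal.span {transitionFromOne t n c ^ p} := by
  have h1 : levelIdeal A I (n + 1) =
      (levelIdeal A I 1).map (transitionFromOne t n : A 1 →+* A (n + 1)) := by
    rw [levelIdeal, levelIdeal, Ideal.map_map, AlgHom.comp_algebraMap]
  rw [h1, ← hf.firstPillar.pow_eq, Ideal.span_singleton_pow, Ideal.map_span, Set.image_singleton,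
    map_pow]
  rfl

/-- Write `c'` for the image of `c`, so that `I₀ R_{n+1} = (c' ^ p)`. A lift `b` of `y` satisfies
`c' * b = c' ^ p * d`, so `b - c' ^ (p - 1) * d` is killed by `c'` and hence torsion; the subtracted
term dies under `F_n`, whose kernel is generated by `c'`. -/
theorem exists_mk_of_mul_eq_zero (hf : IsTiltGenerator h c f) {n i : ℕ} (hi : i ≤ n) {y : LevelQuot A I (n + 1)}
    (hy : f (n + 1) ^ p ^ i * y = 0) : ∃ z ∈ idealTorsion I (A (n + 1)),
      frobeniusProjection h n y = frobeniusProjection h n (Ideal.Quotient.mk _ z) := by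
  obtain ⟨b, rfl⟩ := Ideal.Quotient.mk_surjective y
  have h1 : f (n + 1) ^ p ^ n * Ideal.Quotient.mk _ b = 0 := by
    obtain ⟨m, hm⟩ := pow_dvd_pow (f (n + 1)) (Nat.pow_le_pow_right hp.out.pos hi)
    rw [hm, mul_right_comm, hy, zero_mul]
  obtain ⟨q, hq⟩ : ∃ q, p = q + 2 := ⟨p - 2, by have := hp.out.two_le; omega⟩
  rw [hf.pow_succ_eq, ← map_mul, Ideal.Quotient.eq_zero_iff_mem, hf.levelIdeal_succ,
    Ideal.mem_span_singleton] at h1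
  obtain ⟨d, hd⟩ := h1
  set c' := transitionFromOne t n c with hc'
  have hz : c' * (b - c' * (c' ^ q * d)) = 0 := by
    rw [mul_sub, hd, hq]
    ring
  refine ⟨b - c' * (c' ^ q * d), fun a ha => ⟨1, one_pos, ?_⟩, ?_⟩
  · have h2 : algebraMap R (A (n + 1)) a ∈ levelIdeal A I (n + 1) := Ideal.mem_map_of_mem _ ha
    rw [hf.levelIdeal_succ, Ideal.mem_span_singleton] at h2
    obtain ⟨e, he⟩ := h2
    rw [pow_one, Algebra.smul_def, he, ← hc', hq, pow_succ, mul_right_comm, mul_assoc _ c' _, hz,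
      mul_zero, zero_mul]
  · rw [← sub_eq_zero, ← map_sub, ← map_sub, sub_sub_cancel, map_mul, ← RingHom.mem_ker, hf.ker_eq,
      hf.pow_succ_eq, ← hc']
    exact Ideal.mul_mem_right _ _ (Ideal.mem_span_singleton_self _)

/-- The element of the small tilt `R_i^{s.♭}` given by a system of `p`-power roots. -/
def tilt (hf : IsTiltGenerator h c f) (i : ℕ) : smallTilt h i :=
  ⟨fun m => f (i + m), fun m => hf.frobenius (i + m)⟩

theorem exists_eq_pow_mul (hf : IsTiltGenerator h c f) {i : ℕ} (hF : ∀ n, Function.Surjective (frobeniusProjection h n))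
    {x : smallTilt h i} (hx : x.1 0 = 0) (m : ℕ) : ∃ y, x.1 m = f (i + m) ^ p ^ i * y := by
  induction m with
  | zero => exact ⟨0, by rw [hx, mul_zero]⟩
  | succ m ih =>
    obtain ⟨y, hy⟩ := ih
    obtain ⟨y, rfl⟩ := hF (i + m) y
    -- Lifting the factorization leaves an error in `ker F_{i+m}`, generated by the `p ^ (i + m)`-th
    -- power of `f (i + m + 1)` and so divisible by its `p ^ i`-th power.
    have h1 : x.1 (m + 1) - f (i + m + 1) ^ p ^ i * y ∈
        RingHom.ker (frobeniusProjection h (i + m)) := by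
      rw [RingHom.mem_ker, map_sub, map_mul, map_pow, hf.frobenius, ← hy, sub_eq_zero]
      exact x.2 m
    rw [hf.ker_eq, Ideal.mem_span_singleton] at h1
    obtain ⟨z, hz⟩ := (pow_dvd_pow (f (i + m + 1))
      (Nat.pow_le_pow_right hp.out.pos (Nat.le_add_right i m))).trans h1
    refine ⟨z + y, ?_⟩
    rw [sub_eq_iff_eq_add, ← mul_add] at hz
    exact hz

end

variable (h : IsPreperfectoid p I t) {c : A 1} {f : ∀ n, LevelQuot A I n}

/-- Induction from `f 0 = 0`: the product of a lift of `f (n + 1)` with a torsion element is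
torsion, its image under `F_n` vanishes by induction, and `F_n` is injective on torsion. -/
theorem mul_mk_eq_zero (hf : IsTiltGenerator h.insep c f) (n : ℕ) {x : A n} (hx : x ∈ idealTorsion I (A n)) :
    f n * Ideal.Quotient.mk _ x = 0 := by
  induction n with
  | zero => rw [hf.zero, zero_mul]
  | succ n ih =>
    obtain ⟨e, -, he⟩ := exists_torsionEquiv h n
    obtain ⟨b, hb⟩ := Ideal.Quotient.mk_surjective (f (n + 1))
    have hbx : b * x ∈ idealTorsion I (A (n + 1)) := by
      intro a ha
      obtain ⟨k, hk, hkx⟩ := hx a ha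
      exact ⟨k, hk, by rw [← mul_smul_comm, hkx, mul_zero]⟩
    have h1 : (e ⟨b * x, hbx⟩ : A n) = 0 := by
      refine eq_of_mk_eq_of_mem_idealTorsion h.principal (h.smul_torsion n)
        (e ⟨b * x, hbx⟩).2 (zero_mem _) ?_
      have h2 := ih (e ⟨x, hx⟩).2
      rw [he] at h2
      rw [he, map_zero, map_mul, map_mul, hb, hf.frobenius]
      exact h2
    have h2 : (⟨b * x, hbx⟩ : idealTorsion I (A (n + 1))) = 0 :=
      e.injective ((Subtype.ext h1).trans e.map_zero.symm)
    rw [← hb, ← map_mul, show b * x = 0 from congrArg Subtype.val h2, map_zero]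

theorem pow_mul_mk_eq_zero (hf : IsTiltGenerator h.insep c f) (n i : ℕ) {x : A n} (hx : x ∈ idealTorsion I (A n)) :
    f n ^ p ^ i * Ideal.Quotient.mk _ x = 0 := by
  obtain ⟨k, hk⟩ := Nat.exists_eq_succ_of_ne_zero (pow_pos hp.out.pos i).ne'
  rw [hk, pow_succ, mul_assoc, hf.mul_mk_eq_zero h n hx, mul_zero]

/-- A sequence that is compatible with the Frobenius projections up to torsion can be corrected by
torsion elements to an element of the small tilt. -/
theorem exists_smallTilt_eq_add_torsion {i : ℕ} (w : ∀ m, LevelQuot A I (i + m))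
    (hw : ∀ m, ∃ z ∈ idealTorsion I (A (i + m)),
      frobeniusProjection h.insep (i + m) (w (m + 1)) = w m + Ideal.Quotient.mk _ z) :
    ∃ v : smallTilt h.insep i, ∀ m, ∃ z ∈ idealTorsion I (A (i + m)),
      v.1 m = w m + Ideal.Quotient.mk _ z := by
  let P : ∀ m, LevelQuot A I (i + m) → Prop := fun m y =>
    ∃ z ∈ idealTorsion I (A (i + m)), y = w m + Ideal.Quotient.mk _ z
  have step : ∀ m (y : Subtype (P m)), ∃ y' : Subtype (P (m + 1)),
      frobeniusProjection h.insep (i + m) y'.1 = y.1 := by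
    rintro m ⟨_, z, hz, rfl⟩
    obtain ⟨z', hz', hw'⟩ := hw m
    obtain ⟨e, -, he⟩ := exists_torsionEquiv h (i + m)
    -- The torsion bijection solves for the correction at level `m + 1` that cancels both the
    -- previous correction `z` and the defect `z'`.
    have h1 := he (e.symm ⟨z - z', sub_mem hz hz'⟩)
    rw [AddEquiv.apply_symm_apply, map_sub] at h1
    refine ⟨⟨_, e.symm ⟨z - z', sub_mem hz hz'⟩, Subtype.prop _, rfl⟩, ?_⟩
    refine (map_add _ _ _).trans ((congrArg₂ (· + ·) hw' h1.symm).trans ?_)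
    ring
  choose next hnext using step
  let v : ∀ m, Subtype (P m) := fun m => Nat.rec ⟨w 0, 0, zero_mem _, by rw [map_zero, add_zero]⟩
    (fun m y => next m y) m
  exact ⟨⟨fun m => (v m).1, fun m => hnext m (v m)⟩, fun m => (v m).2⟩

/-- The kernel of the projection `R_i^{s.♭} → R_i / I₀ R_i` is principal. -/
theorem ker_smallTiltProj (hf : IsTiltGenerator h.insep c f) (i : ℕ) :
    RingHom.ker (smallTiltProj h.insep i) = Ideal.span {hf.tilt i ^ p ^ i} := by
  refine le_antisymm (fun x hx => ?_) ?_
  · have hx0 : x.1 0 = 0 := hx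
    choose y hy using hf.exists_eq_pow_mul h.surjective hx0
    have hFf : ∀ n, frobeniusProjection h.insep n (f (n + 1) ^ p ^ i) = f n ^ p ^ i := fun n => by
      rw [map_pow, hf.frobenius]
    -- The cofactors `y m` are compatible only up to the annihilator of `f ^ p ^ i`. Pushing them
    -- down one level by `F` turns this defect into torsion.
    let w : ∀ m, LevelQuot A I (i + m) := fun m => frobeniusProjection h.insep (i + m) (y (m + 1))
    have hs : ∀ m, ∃ z ∈ idealTorsion I (A (i + m)),
        frobeniusProjection h.insep (i + m) (w (m + 1)) = w m + Ideal.Quotient.mk _ z := by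
      intro m
      have h1 : f (i + m + 1) ^ p ^ i *
          (frobeniusProjection h.insep (i + (m + 1)) (y (m + 2)) - y (m + 1)) = 0 := by
        rw [mul_sub, sub_eq_zero]
        have h2 := x.2 (m + 1)
        rw [hy (m + 2), hy (m + 1)] at h2
        exact (congrArg (· * _) (hFf (i + (m + 1)))).symm.trans ((map_mul _ _ _).symm.trans h2)
      obtain ⟨z, hz, hzF⟩ := hf.exists_mk_of_mul_eq_zero (Nat.le_add_right i m) h1
      obtain ⟨e, -, he⟩ := exists_torsionEquiv h (i + m)
      refine ⟨e ⟨z, hz⟩, (e ⟨z, hz⟩).2, ?_⟩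
      rw [he, ← hzF, map_sub]
      exact (add_sub_cancel _ _).symm
    obtain ⟨v, hv⟩ := exists_smallTilt_eq_add_torsion h w hs
    have hxw : ∀ m, x.1 m = f (i + m) ^ p ^ i * w m := fun m =>
      (x.2 m).symm.trans ((congrArg (frobeniusProjection h.insep (i + m)) (hy (m + 1))).trans
        ((map_mul _ _ _).trans (congrArg (· * w m) (hFf (i + m)))))
    -- Torsion is killed by `f`, so correcting `w` to the compatible `v` does not change the
    -- product.
    have hxv : ∀ m, x.1 m = f (i + m) ^ p ^ i * v.1 m := fun m => by
      obtain ⟨τ, hτ, hvm⟩ := hv m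
      rw [hvm, mul_add, hf.pow_mul_mk_eq_zero h _ _ hτ, add_zero, hxw]
    have hxv' : x = hf.tilt i ^ p ^ i * v := Subtype.ext (funext hxv)
    exact Ideal.mem_span_singleton.mpr ⟨v, hxv'⟩
  · rw [Ideal.span_singleton_le_iff_mem]
    exact hf.pow_eq_zero i

/-- Each pillar is a preimage under `F_i`, and the preimage of `(f i)` is `(f (i + 1)) + ker F_i`;
the kernel is absorbed, being generated by a positive power of `f (i + 1)`. -/
theorem map_pillar (hf : IsTiltGenerator h.insep c f) (i : ℕ) :
    (pillar h i).map (Ideal.Quotient.mk (levelIdeal A I i)) = Ideal.span {f i} := by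
  induction i with
  | zero =>
    rw [(isPillarSequence_pillar h).zero, hf.zero, Ideal.map_quotient_self]
    exact (Ideal.span_singleton_eq_bot.mpr rfl).symm
  | succ i ih =>
    have h1 : Ideal.span {f i} =
        (Ideal.span {f (i + 1)}).map (frobeniusProjection h.insep i) := by
      rw [Ideal.map_span, Set.image_singleton, hf.frobenius]
    rw [(isPillarSequence_pillar h).eq_comap i,
      Ideal.map_comap_of_surjective _ Ideal.Quotient.mk_surjective, ih, h1,
      Ideal.comap_map_of_surjective _ (h.surjective i), sup_eq_left]
    refine (hf.ker_eq i).le.trans ?_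
    rw [Ideal.span_singleton_le_iff_mem]
    exact Ideal.pow_mem_of_mem _ (Ideal.mem_span_singleton_self _) _ (pow_pos hp.out.pos i)

/-- The small tilt of the `i`-th perfectoid pillar is principal. -/
theorem pillarTilt_eq (hf : IsTiltGenerator h.insep c f) (i : ℕ) : pillarTilt h i = Ideal.span {hf.tilt i} := by
  have hmem : ∀ x, x ∈ pillarTilt h i ↔ f i ∣ x.1 0 := fun x => by
    rw [pillarTilt, RingHom.mem_ker, RingHom.comp_apply, Ideal.Quotient.eq_zero_iff_mem,
      hf.map_pillar h i, Ideal.mem_span_singleton]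
    rfl
  refine le_antisymm (fun x hx => ?_) ?_
  · obtain ⟨y, hy⟩ := (hmem x).mp hx
    let g : ∀ m, LevelQuot A I (i + m) := fun m => Nat.rec y
      (fun m y => Function.surjInv (h.surjective (i + m)) y) m
    let v : smallTilt h.insep i :=
      ⟨g, fun m => Function.surjInv_eq (h.surjective (i + m)) (g m)⟩
    -- Here `v` lifts the cofactor `y` of `x.1 0`. The difference lies in the ideal generated by a
    -- positive power of the tilt element, hence is itself a multiple of that element.
    have h1 : x - hf.tilt i * v ∈ RingHom.ker (smallTiltProj h.insep i) := by
      rw [RingHom.mem_ker, map_sub, sub_eq_zero]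
      exact hy
    rw [hf.ker_smallTiltProj h i, Ideal.mem_span_singleton] at h1
    refine Ideal.mem_span_singleton.mpr ?_
    exact (dvd_sub_left (dvd_mul_right _ v)).mp
      ((dvd_pow_self _ (pow_pos hp.out.pos i).ne').trans h1)
  · rw [Ideal.span_singleton_le_iff_mem, hmem]
    exact dvd_rfl

end IsTiltGenerator

theorem IsTiltGenerator.baseChange {S : Type*} [CommRing S] [Algebra R S]
    [Algebra.WeaklyEtale R S] (h : IsPreperfectoid p I t)
    (h' : IsPurelyInseparable p (I.map (algebraMap R S)) (baseChange S t)) {c : A 1}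
    {f : ∀ n, LevelQuot A I n} (hf : IsTiltGenerator h.insep c f) :
    IsTiltGenerator h' (toBaseChange S A 1 c) (fun n => levelQuotToBaseChange S I A n (f n)) where
  firstPillar := by
    have := hf.firstPillar.baseChange h' h.surjective
    rwa [Ideal.map_span, Set.image_singleton] at this
  zero := by rw [hf.zero, map_zero]
  one := by rw [hf.one]; rfl
  frobenius n := (quotientMap_frobeniusProjection h.insep h' (toBaseChange S A)
    (toBaseChange_comm S t) (levelIdeal_le_comap_toBaseChange S I) n _).trans
      (congrArg (levelQuotToBaseChange S I A n) (hf.frobenius n))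

end TiltGenerator

end PerfectoidTower

theorem mainTheorem7 (p : ℕ) [Fact p.Prime] {R : Type*} [CommRing R] (I₀ : Ideal R)
    {A : ℕ → Type*} [∀ i, CommRing (A i)] [∀ i, Algebra R (A i)]
    (t : ∀ i, A i →ₐ[R] A (i + 1)) (hR : IsPreperfectoid p I₀ t)
    (S : Type*) [CommRing S] [Algebra R S] [Algebra.WeaklyEtale R S] :
    ∃ hS : IsPreperfectoid p (I₀.map (algebraMap R S)) (baseChange S t), ∀ i,
      pillar hS i = (pillar hR i).map (toBaseChange S A i) ∧
      pillarTilt hS i =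
        (pillarTilt hR i).map (smallTiltToBaseChange S hR.insep hS.insep i) ∧
      RingHom.ker (smallTiltProj hS.insep i) =
        (RingHom.ker (smallTiltProj hR.insep i)).map
          (smallTiltToBaseChange S hR.insep hS.insep i) := by
  have hS := hR.baseChange (S := S)
  obtain ⟨c, f, hf⟩ := exists_isTiltGenerator hR
  have hf' := hf.baseChange (S := S) hR hS.insep
  -- The generators correspond under the map of tilts, so both ideals of the new tower are generated
  -- by images from the old one.
  have htilt : ∀ i, smallTiltToBaseChange S hR.insep hS.insep i (hf.tilt i) = hf'.tilt i :=
    fun i => rfl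
  refine ⟨hS, fun i => ⟨pillar_baseChange hR hS i, ?_, ?_⟩⟩
  · rw [hf.pillarTilt_eq hR, hf'.pillarTilt_eq hS, Ideal.map_span, Set.image_singleton, htilt]
  · rw [hf.ker_smallTiltProj hR, hf'.ker_smallTiltProj hS, Ideal.map_span, Set.image_singleton, map_pow,
      htilt]
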